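/- For a non-constant monic polynomial $f\in\mathbb Z[x]$, a root of maximal modulus is a complex root $\alpha$ of $f$ such that $|\alpha|\ge|\beta|$ for every complex root $\beta$ of $f$. The height of $f$ is the maximum of the absolute values of its coefficients. For positive integers $k\le n$ and $H$, let $D_n(k,H)$ be the number of monic polynomials in $\mathbb Z[x]$ of degree $n$ and height at most $H$ that have exactly $k$ roots of maximal modulus, counted with multiplicity. Theorem. Let $n\ge k\ge 3$ be integers. There are constants $c,C>0$, depending only on $n$ and $k$, such that for every integer $H\ge 1$: if $k$ is odd, then $$c\,H^{\frac{n+1}{2}-k+\frac{5k^2-4k+7}{8n}}\le D_n(k,H)\le C\,H^{\,n-\frac{k+1}{2}};$$ if $k$ is even, then $$c\,H^{\frac{n+1}{2}-k+\frac{5k^2-2k+16}{8n}}\le D_n(k,H)\le C\,H^{\,n-\frac{k-1}{2}}.$$ -/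

import Mathlib

open Polynomial
open scoped NNReal

namespace DominantRoots

/-- The height of an integer polynomial: the maximum of the absolute values of its coefficients. -/
def height (f : ℤ[X]) : ℕ :=
  f.support.sup fun i => (f.coeff i).natAbs

/-- The largest modulus of the complex roots of `f` (the house, or inclusion radius, of `f`). -/
noncomputable def house (f : ℤ[X]) : ℝ≥0 :=
  ((f.map (Int.castRingHom ℂ)).roots.map fun z => ‖z‖₊).sup

open Classical in
/-- The number of complex roots of `f` of maximal modulus, counted with multiplicity. -/
noncomputable def numDominantRoots (f : ℤ[X]) : ℕ :=
  (f.map (Int.castRingHom ℂ)).roots.countP fun z => ‖z‖₊ = house f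

/-- The monic integer polynomials of degree `n` and height at most `H` with exactly `k` roots
of maximal modulus, counted with multiplicity. -/
def dominantSet (n k H : ℕ) : Set ℤ[X] :=
  {f | f.Monic ∧ f.natDegree = n ∧ height f ≤ H ∧ numDominantRoots f = k}

theorem natAbs_coeff_le_height (f : ℤ[X]) (i : ℕ) : (f.coeff i).natAbs ≤ height f := by
  by_cases h : i ∈ f.support
  · exact Finset.le_sup (f := fun i => (f.coeff i).natAbs) h
  · simp [notMem_support_iff.mp h]

/-- The set being counted is finite, so that its `Set.ncard` is its number of elements. -/
theorem dominantSet_finite (n k H : ℕ) : (dominantSet n k H).Finite := by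
  have hfin : (Set.univ.pi fun _ : Fin (n + 1) => Set.Icc (-(H : ℤ)) H).Finite :=
    Set.Finite.pi fun _ => Set.finite_Icc _ _
  refine Set.Finite.of_finite_image (f := fun f : ℤ[X] => fun i : Fin (n + 1) => f.coeff i)
    (hfin.subset ?_) ?_
  · rintro _ ⟨f, hf, rfl⟩ i -
    have h := (natAbs_coeff_le_height f i).trans hf.2.2.1
    simp only [Set.mem_Icc]
    omega
  · intro f hf g hg hfg
    ext i
    by_cases hi : i < n + 1
    · exact congrFun hfg ⟨i, hi⟩
    · rw [coeff_eq_zero_of_natDegree_lt (by have := hf.2.1; omega),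
        coeff_eq_zero_of_natDegree_lt (by have := hg.2.1; omega)]

/-- The counting function `D_n(k, H)`. -/
noncomputable def D (n k H : ℕ) : ℕ := (dominantSet n k H).ncard

end DominantRoots

/-!
Both halves rest on comparing the coefficients with the maximal modulus `R` of the roots.

*Upper bounds.* If `k` roots have modulus `R`, then `R ^ k` is at most the Mahler measure of `f`,
so `R = O(H ^ (1 / k))` and the coefficient of `X ^ (n - i)` is `O(H ^ (min i k / k))`
(`abs_coeff_le_rpow`). Counting the integer points of this box gives the exponent
`n - (k - 1) / 2`, which is the bound for even `k`.

For odd `k` one more power of `H` has to be saved. If the roots are distinct, one of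
the `k` roots is real, `x = ± R`, and together with a pair of complex conjugates it gives a relation
`x ^ 2 = y * w` between distinct roots (`hasGeometricTriple_of_odd`). By the fundamental theorem
of symmetric polynomials, the existence of such a relation, or of a double root, is the vanishing
of a polynomial `Ψ` in the coefficients. When `k < n`, the two lowest coefficients both range over
`[-H, H]`. Whatever the other coefficients are, `Ψ` does not vanish identically in these two: a
rescaling of the roots deforms `f` to `X ^ n + X - 1`, which has no such relation
(`exists_eval_ne_zero`). The Schwartz–Zippel lemma then leaves `O(H)` of the `O(H ^ 2)` pairs. When
`k = n`, all the roots lie on one circle, `f` is self-reciprocal up to scaling, and the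
coefficients of index at least one determine `R`, hence the constant coefficient up to sign, unless
`f = X ^ n + a` (`upper_bound_odd_self`).

*Lower bounds.* Take `f = L * G * h`, with `R ^ 2 = r` an integer of size `H ^ (2 / n)`. The factor
`h` has degree `n - k` and coefficients so small that its roots satisfy `|z| < R`. The factor `G`,
of degree `2 * m` with `m = k / 2` rounded down, is a small self-reciprocal perturbation of
`X ^ (2 * m) + r ^ m`; on the circle `|z| = R` it is a real trigonometric polynomial up to the factor
`z ^ m`, and its sign changes put all its roots on the circle. Finally `L` is `1` for even `k`, and
`X - R`, with `R` itself an integer, for odd `k`. The factorization is determined by the product,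
and all the coefficients of `f` are at most `2 ^ n * R ^ n`.
-/

namespace DominantRoots

/-! ### Roots, heights and the maximal modulus -/

/-- The multiset of complex roots of an integer polynomial. -/
noncomputable abbrev complexRoots (f : ℤ[X]) : Multiset ℂ := (f.map (Int.castRingHom ℂ)).roots

theorem mem_complexRoots {f : ℤ[X]} (hf : f.Monic) {z : ℂ} :
    z ∈ complexRoots f ↔ aeval z f = 0 := by
  rw [mem_roots (hf.map _).ne_zero, IsRoot, eval_map, aeval_def]
  rfl

theorem card_complexRoots {f : ℤ[X]} (hf : f.Monic) : (complexRoots f).card = f.natDegree := by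
  rw [splits_iff_card_roots.1 (IsAlgClosed.splits _), hf.natDegree_map]

theorem map_eq_prod_complexRoots {f : ℤ[X]} (hf : f.Monic) :
    f.map (Int.castRingHom ℂ) = ((complexRoots f).map fun z => X - C z).prod :=
  (IsAlgClosed.splits _).eq_prod_roots_of_monic (hf.map _)

theorem complexRoots_mul {f g : ℤ[X]} (hf : f.Monic) (hg : g.Monic) :
    complexRoots (f * g) = complexRoots f + complexRoots g := by
  rw [complexRoots, Polynomial.map_mul, roots_mul]
  exact mul_ne_zero (hf.map _).ne_zero (hg.map _).ne_zero

theorem eq_of_complexRoots_eq {f g : ℤ[X]} (hf : f.Monic) (hg : g.Monic)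
    (h : complexRoots f = complexRoots g) : f = g := by
  apply map_injective (Int.castRingHom ℂ) (Int.cast_injective)
  rw [map_eq_prod_complexRoots hf, map_eq_prod_complexRoots hg, h]

theorem nnnorm_le_house {f : ℤ[X]} {z : ℂ} (hz : z ∈ complexRoots f) : ‖z‖₊ ≤ house f :=
  Multiset.le_sup (Multiset.mem_map_of_mem _ hz)

theorem norm_le_house {f : ℤ[X]} {z : ℂ} (hz : z ∈ complexRoots f) : ‖z‖ ≤ house f := by
  exact_mod_cast nnnorm_le_house hz

theorem pow_countP_le_prod_max_one (s : Multiset ℂ) (R : ℝ≥0)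
    [DecidablePred fun z : ℂ => ‖z‖₊ = R] :
    (R : ℝ) ^ (s.countP fun z => ‖z‖₊ = R) ≤ (s.map fun z => max 1 ‖z‖).prod := by
  induction s using Multiset.induction_on with
  | empty => simp
  | cons a s ih =>
    rw [Multiset.map_cons, Multiset.prod_cons, Multiset.countP_cons]
    have h0 : 0 ≤ (R : ℝ) ^ (s.countP fun z => ‖z‖₊ = R) := by positivity
    split_ifs with h
    · rw [pow_succ, mul_comm]
      have : (R : ℝ) ≤ max 1 ‖a‖ := by
        rw [← h]; exact le_max_right _ _
      gcongr
    · calc _ = 1 * (R : ℝ) ^ (s.countP fun z => ‖z‖₊ = R) := by simp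
        _ ≤ _ := by gcongr; exact le_max_left _ _

/-- If `k` roots have the maximal modulus `R`, then `R ^ k` is at most the Mahler measure of `f`,
hence at most a constant times the height. -/
theorem house_pow_le {n k H : ℕ} {f : ℤ[X]} (hf : f ∈ dominantSet n k H) :
    (house f : ℝ) ^ k ≤ (n + 1) * H := by
  obtain ⟨hmon, hdeg, hht, hk⟩ := hf
  classical
  calc (house f : ℝ) ^ k ≤ ((complexRoots f).map fun z => max 1 ‖z‖).prod := by
        rw [← hk, numDominantRoots]
        convert pow_countP_le_prod_max_one (complexRoots f) (house f)
    _ = (f.map (Int.castRingHom ℂ)).mahlerMeasure := by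
        rw [mahlerMeasure_eq_leadingCoeff_mul_prod_roots, (hmon.map _).leadingCoeff]
        simp
    _ ≤ _ := mahlerMeasure_le_sum_norm_coeff _
    _ ≤ _ := by
        rw [sum_over_range' _ (by simp) (n + 1) (by rw [hmon.natDegree_map, hdeg]; omega)]
        calc _ ≤ ∑ i ∈ Finset.range (n + 1), (H : ℝ) := by
              apply Finset.sum_le_sum
              intro i _
              rw [coeff_map, eq_intCast, Complex.norm_intCast, ← Int.cast_abs, Int.abs_eq_natAbs]
              exact_mod_cast (natAbs_coeff_le_height f i).trans hht
          _ = _ := by simp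

theorem abs_coeff_le_height {n k H : ℕ} {f : ℤ[X]} (hf : f ∈ dominantSet n k H) (i : ℕ) :
    |(f.coeff i : ℝ)| ≤ H := by
  rw [← Int.cast_abs, Int.abs_eq_natAbs]
  exact_mod_cast (natAbs_coeff_le_height f i).trans hf.2.2.1

/-- The coefficient bound from elementary symmetric functions of roots in a disc. -/
theorem abs_coeff_le_of_norm_le {f : ℤ[X]} (hf : f.Monic) {R : ℝ}
    (hR : ∀ z ∈ complexRoots f, ‖z‖ ≤ R) (i : ℕ) :
    |(f.coeff i : ℝ)| ≤ R ^ (f.natDegree - i) * f.natDegree.choose i := by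
  have := coeff_le_of_roots_le i hf (IsAlgClosed.splits (f.map (Int.castRingHom ℂ))) hR
  rwa [coeff_map, eq_intCast, Complex.norm_intCast] at this

/-- Since the maximal modulus is `O(H ^ (1 / k))`, the coefficient of `X ^ i` is
`O(H ^ ((n - i) / k))`, which improves on the height bound for `n - i < k`. -/
theorem abs_coeff_le_rpow {n k H : ℕ} (hk : 1 ≤ k) (hH : 1 ≤ H) {f : ℤ[X]}
    (hf : f ∈ dominantSet n k H) (i : ℕ) :
    |(f.coeff i : ℝ)| ≤ (2 ^ n * (n + 1) : ℝ) * (H : ℝ) ^ ((min (n - i) k : ℕ) / (k : ℝ)) := by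
  have hk0 : (0 : ℝ) < k := by exact_mod_cast hk
  have hH1 : (1 : ℝ) ≤ H := by exact_mod_cast hH
  have h2 : (1 : ℝ) ≤ 2 ^ n := one_le_pow₀ (by norm_num)
  by_cases hik : k ≤ n - i
  · rw [min_eq_right hik, div_self hk0.ne', Real.rpow_one]
    refine (abs_coeff_le_height hf i).trans ?_
    have : (1 : ℝ) ≤ 2 ^ n * (n + 1) := by
      have : (0 : ℝ) ≤ n := by positivity
      nlinarith
    nlinarith
  · have hle : n - i ≤ k := by omega
    rw [min_eq_left hle]
    have h1 := abs_coeff_le_of_norm_le hf.1 (fun z hz => norm_le_house hz) i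
    rw [hf.2.1] at h1
    have hn1 : (1 : ℝ) ≤ n + 1 := by
      have : (0 : ℝ) ≤ n := by positivity
      linarith
    have hhouse : (house f : ℝ) ^ (n - i) ≤ (n + 1) * (H : ℝ) ^ ((n - i : ℕ) / (k : ℝ)) := by
      have h3 : ((house f : ℝ) ^ k) ^ (((n - i : ℕ) : ℝ) / k) ≤
          ((n + 1) * H : ℝ) ^ (((n - i : ℕ) : ℝ) / k) :=
        Real.rpow_le_rpow (by positivity) (house_pow_le hf) (by positivity)
      rw [← Real.rpow_natCast_mul (by positivity), mul_div_cancel₀ _ hk0.ne', Real.rpow_natCast,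
        Real.mul_rpow (by positivity) (by positivity)] at h3
      refine h3.trans ?_
      gcongr
      calc (n + 1 : ℝ) ^ (((n - i : ℕ) : ℝ) / k) ≤ (n + 1 : ℝ) ^ (1 : ℝ) := by
            apply Real.rpow_le_rpow_of_exponent_le hn1
            rw [div_le_one hk0]
            exact_mod_cast hle
        _ = _ := Real.rpow_one _
    calc _ ≤ _ := h1
      _ ≤ ((n + 1) * (H : ℝ) ^ ((n - i : ℕ) / (k : ℝ))) * 2 ^ n := by
          gcongr
          exact_mod_cast Nat.choose_le_two_pow n i
      _ = _ := by ring

/-- If `f = A * h` where the roots of `A` lie on the circle of radius `R` and those of `h` inside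
it, then `A` accounts for exactly the roots of maximal modulus. -/
theorem filter_complexRoots_mul {A h : ℤ[X]} (hA : A.Monic) (hh : h.Monic) {R : ℝ}
    [DecidablePred fun z : ℂ => ‖z‖ = R]
    (hAR : ∀ z ∈ complexRoots A, ‖z‖ = R) (hhR : ∀ z ∈ complexRoots h, ‖z‖ < R) :
    (complexRoots (A * h)).filter (fun z => ‖z‖ = R) = complexRoots A := by
  rw [complexRoots_mul hA hh, Multiset.filter_add, Multiset.filter_eq_self.2 hAR,
    Multiset.filter_eq_nil.2 fun z hz => (hhR z hz).ne]
  simp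

theorem house_mul_eq {A h : ℤ[X]} (hA : A.Monic) (hh : h.Monic) {R : ℝ} (hdeg : A.natDegree ≠ 0)
    (hAR : ∀ z ∈ complexRoots A, ‖z‖ = R) (hhR : ∀ z ∈ complexRoots h, ‖z‖ < R) :
    (house (A * h) : ℝ) = R := by
  obtain ⟨w, hw⟩ : ∃ w, w ∈ complexRoots A := by
    apply Multiset.card_pos_iff_exists_mem.1
    rw [card_complexRoots hA]
    omega
  apply le_antisymm
  · have hR : 0 ≤ R := by rw [← hAR w hw]; positivity
    lift R to ℝ≥0 using hR
    rw [NNReal.coe_le_coe, house, Multiset.sup_le]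
    intro b hb
    obtain ⟨z, hz, rfl⟩ := Multiset.mem_map.1 hb
    have hz : z ∈ complexRoots (A * h) := hz
    rw [complexRoots_mul hA hh, Multiset.mem_add] at hz
    rw [← NNReal.coe_le_coe, coe_nnnorm]
    rcases hz with hz | hz
    · exact (hAR z hz).le
    · exact (hhR z hz).le
  · rw [← hAR w hw]
    apply norm_le_house
    rw [complexRoots_mul hA hh, Multiset.mem_add]
    exact Or.inl hw

theorem numDominantRoots_mul_eq {A h : ℤ[X]} (hA : A.Monic) (hh : h.Monic) {R : ℝ}
    (hdeg : A.natDegree ≠ 0)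
    (hAR : ∀ z ∈ complexRoots A, ‖z‖ = R) (hhR : ∀ z ∈ complexRoots h, ‖z‖ < R) :
    numDominantRoots (A * h) = A.natDegree := by
  classical
  have hhouse := house_mul_eq hA hh hdeg hAR hhR
  rw [← card_complexRoots hA, ← filter_complexRoots_mul hA hh hAR hhR, numDominantRoots,
    Multiset.countP_eq_card_filter]
  congr 1
  apply Multiset.filter_congr
  intro z _
  rw [← hhouse, ← NNReal.coe_inj, coe_nnnorm]

/-- A product of a factor with all roots on the circle of radius `R` and a factor with all roots
inside it determines both factors. -/
theorem circle_disc_factor_unique {A h A' h' : ℤ[X]} (hA : A.Monic) (hh : h.Monic)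
    (hA' : A'.Monic) (hh' : h'.Monic) {R : ℝ}
    (hAR : ∀ z ∈ complexRoots A, ‖z‖ = R) (hhR : ∀ z ∈ complexRoots h, ‖z‖ < R)
    (hAR' : ∀ z ∈ complexRoots A', ‖z‖ = R) (hhR' : ∀ z ∈ complexRoots h', ‖z‖ < R)
    (heq : A * h = A' * h') : A = A' ∧ h = h' := by
  classical
  have h1 : A = A' := by
    apply eq_of_complexRoots_eq hA hA'
    rw [← filter_complexRoots_mul hA hh hAR hhR, heq, filter_complexRoots_mul hA' hh' hAR' hhR']
  subst h1
  exact ⟨rfl, mul_left_cancel₀ hA.ne_zero heq⟩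

/-! ### Factors with all roots on a circle or in a disc -/

/-- The integer vectors `c` with `|c i| ≤ B i`. -/
noncomputable def intBox {N : ℕ} (B : Fin N → ℝ) : Finset (Fin N → ℤ) :=
  Fintype.piFinset fun i => Finset.Icc (-⌊B i⌋) ⌊B i⌋

theorem mem_intBox {N : ℕ} {B : Fin N → ℝ} {c : Fin N → ℤ} :
    c ∈ intBox B ↔ ∀ i, |(c i : ℝ)| ≤ B i := by
  simp only [intBox, Fintype.mem_piFinset, Finset.mem_Icc]
  refine forall_congr' fun i => ?_
  rw [← abs_le, Int.le_floor, Int.cast_abs]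

theorem card_intBox {N : ℕ} {B : Fin N → ℝ} (hB : ∀ i, 0 ≤ B i) :
    ((intBox B).card : ℝ) = ∏ i, (2 * (⌊B i⌋ : ℝ) + 1) := by
  rw [intBox, Fintype.card_piFinset]
  push_cast
  refine Finset.prod_congr rfl fun i _ => ?_
  have h0 : 0 ≤ ⌊B i⌋ := Int.floor_nonneg.2 (hB i)
  rw [Int.card_Icc, ← Int.cast_natCast, Int.toNat_of_nonneg (by omega)]
  push_cast
  ring

theorem prod_le_card_intBox {N : ℕ} {B : Fin N → ℝ} (hB : ∀ i, 0 ≤ B i) :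
    ∏ i, B i ≤ ((intBox B).card : ℝ) := by
  rw [card_intBox hB]
  refine Finset.prod_le_prod (fun i _ => hB i) fun i _ => ?_
  have h0 : (0 : ℝ) ≤ ⌊B i⌋ := by exact_mod_cast Int.floor_nonneg.2 (hB i)
  have h1 := (Int.lt_floor_add_one (B i)).le
  linarith

theorem card_intBox_le {N : ℕ} {B : Fin N → ℝ} (hB : ∀ i, 1 ≤ B i) :
    ((intBox B).card : ℝ) ≤ ∏ i, 3 * B i := by
  rw [card_intBox fun i => zero_le_one.trans (hB i)]
  refine Finset.prod_le_prod (fun i _ => ?_) fun i _ => ?_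
  · have h0 : (0 : ℝ) ≤ ⌊B i⌋ := by
      exact_mod_cast Int.floor_nonneg.2 (zero_le_one.trans (hB i))
    linarith
  · have h1 := Int.floor_le (B i)
    linarith [hB i]

/-- The integer vectors `c` with `|c i| ≤ (R / 2) ^ (d - i)`. -/
noncomputable def coeffBox (d : ℕ) (R : ℝ) : Finset (Fin d → ℤ) :=
  intBox fun i => (R / 2) ^ (d - i : ℕ)

theorem abs_le_of_mem_coeffBox {d : ℕ} {R : ℝ} {c : Fin d → ℤ} (hc : c ∈ coeffBox d R)
    (i : Fin d) : |(c i : ℝ)| ≤ (R / 2) ^ (d - i : ℕ) :=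
  mem_intBox.1 hc i

theorem sum_fin_sub (d : ℕ) : ∑ i : Fin d, (d - i : ℕ) = d * (d + 1) / 2 := by
  rw [Fin.sum_univ_eq_sum_range (fun i => d - i) d]
  have := Finset.sum_range_reflect (fun i => i + 1) d
  rw [Finset.sum_congr rfl (g := fun i => d - i) (fun i hi => by
    have := Finset.mem_range.1 hi; omega)] at this
  rw [this, Finset.sum_add_distrib, Finset.sum_range_id]
  rcases d with _ | d
  · simp
  · simp only [Finset.sum_const, Finset.card_range, smul_eq_mul, mul_one, Nat.add_sub_cancel]
    rw [show (d + 1) * (d + 1 + 1) = (d + 1) * d + (d + 1) * 2 by ring,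
      Nat.add_mul_div_right _ _ (by norm_num)]

theorem pow_le_card_coeffBox (d : ℕ) {R : ℝ} (hR : 0 ≤ R) :
    (R / 2) ^ (d * (d + 1) / 2) ≤ ((coeffBox d R).card : ℝ) := by
  rw [← sum_fin_sub, ← Finset.prod_pow_eq_pow_sum]
  exact prod_le_card_intBox fun i => by positivity

theorem sum_half_pow_lt (d : ℕ) : ∑ i : Fin d, (1 / 2 : ℝ) ^ (d - i : ℕ) < 1 := by
  rw [Fin.sum_univ_eq_sum_range (fun i => (1 / 2 : ℝ) ^ (d - i)) d]
  have : ∑ i ∈ Finset.range d, (1 / 2 : ℝ) ^ (d - i) = 1 - (1 / 2) ^ d := by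
    induction d with
    | zero => simp
    | succ d ih =>
      rw [Finset.sum_range_succ, Finset.sum_congr rfl (g := fun i => (1 / 2 : ℝ) ^ (d - i) * (1 / 2))
        (fun i hi => by
          rw [← pow_succ]
          congr 1
          have := Finset.mem_range.1 hi; omega), ← Finset.sum_mul, ih]
      simp
      ring
  rw [this]
  have : (0 : ℝ) < (1 / 2) ^ d := by positivity
  linarith

theorem sum_abs_mul_pow_lt {d : ℕ} {x : ℝ} (hx : 0 < x) {c : Fin d → ℤ}
    (hc : ∀ i, |(c i : ℝ)| ≤ (x / 2) ^ (d - i : ℕ)) :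
    ∑ i : Fin d, |(c i : ℝ)| * x ^ (i : ℕ) < x ^ d := by
  calc ∑ i : Fin d, |(c i : ℝ)| * x ^ (i : ℕ)
      ≤ ∑ i : Fin d, x ^ d * (1 / 2 : ℝ) ^ (d - i : ℕ) := by
        apply Finset.sum_le_sum
        intro i _
        calc _ ≤ (x / 2) ^ (d - i : ℕ) * x ^ (i : ℕ) := by gcongr; exact hc i
          _ = x ^ (d - i + i : ℕ) * (1 / 2 : ℝ) ^ (d - i : ℕ) := by
            rw [pow_add, div_pow, one_div_pow]; ring
          _ = _ := by rw [Nat.sub_add_cancel i.2.le]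
    _ = x ^ d * ∑ i : Fin d, (1 / 2 : ℝ) ^ (d - i : ℕ) := by rw [Finset.mul_sum]
    _ < x ^ d * 1 := by gcongr; exact sum_half_pow_lt d
    _ = _ := mul_one _

/-- The monic polynomial of degree `d` with lower coefficients `c`. -/
noncomputable def monicOfCoeffs {A : Type*} [CommRing A] (d : ℕ) (c : Fin d → A) : A[X] :=
  X ^ d + ∑ i : Fin d, C (c i) * X ^ (i : ℕ)

section MonicOfCoeffs

variable {A : Type*} [CommRing A]

theorem degree_monicOfCoeffs_tail_lt (d : ℕ) (c : Fin d → A) :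
    (∑ i : Fin d, C (c i) * X ^ (i : ℕ) : A[X]).degree < d := by
  rw [← mem_degreeLT]
  refine Submodule.sum_mem _ fun i _ => ?_
  rw [mem_degreeLT]
  exact (degree_C_mul_X_pow_le _ _).trans_lt (by exact_mod_cast i.2)

theorem monicOfCoeffs_monic (d : ℕ) (c : Fin d → A) : (monicOfCoeffs d c).Monic :=
  monic_X_pow_add (degree_monicOfCoeffs_tail_lt d c)

theorem natDegree_monicOfCoeffs [Nontrivial A] (d : ℕ) (c : Fin d → A) :
    (monicOfCoeffs d c).natDegree = d := by
  apply natDegree_eq_of_degree_eq_some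
  rw [monicOfCoeffs, degree_add_eq_left_of_degree_lt] <;> rw [degree_X_pow]
  exact degree_monicOfCoeffs_tail_lt d c

theorem coeff_monicOfCoeffs (d : ℕ) (c : Fin d → A) (i : Fin d) :
    (monicOfCoeffs d c).coeff i = c i := by
  simp [monicOfCoeffs, finsetSum_coeff, coeff_X_pow, i.2.ne, Fin.val_inj]

theorem monicOfCoeffs_injective (d : ℕ) : Function.Injective (monicOfCoeffs (A := A) d) := by
  intro c c' h
  ext i
  rw [← coeff_monicOfCoeffs d c, h, coeff_monicOfCoeffs]

end MonicOfCoeffs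

theorem norm_lt_of_mem_complexRoots_monicOfCoeffs {d : ℕ} {R : ℝ} (hR : 0 < R) {c : Fin d → ℤ}
    (hc : c ∈ coeffBox d R) {z : ℂ} (hz : z ∈ complexRoots (monicOfCoeffs d c)) : ‖z‖ < R := by
  by_contra! hle
  rw [mem_complexRoots (monicOfCoeffs_monic d c)] at hz
  simp only [monicOfCoeffs, map_add, map_sum, map_mul, map_pow, aeval_X, aeval_C] at hz
  have h1 : ‖z‖ ^ d ≤ ∑ i : Fin d, |(c i : ℝ)| * ‖z‖ ^ (i : ℕ) := by
    rw [← norm_pow, eq_neg_of_add_eq_zero_left hz, norm_neg]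
    refine (norm_sum_le _ _).trans_eq ?_
    apply Finset.sum_congr rfl
    intro i _
    simp
  refine absurd (sum_abs_mul_pow_lt (hR.trans_le hle) (c := c) fun i => ?_) (not_lt.2 h1)
  refine (abs_le_of_mem_coeffBox hc i).trans ?_
  gcongr

/-- A monic polynomial of degree `2 * m` that is self-reciprocal with respect to the circle of
squared radius `r`. It is a perturbation of `X ^ (2 * m) + r ^ m`. The two terms for `j = 0`
coincide, so that the coefficient of `X ^ m` is `2 * a 0`. -/
noncomputable def circleFactor (m r : ℕ) (a : Fin m → ℤ) : ℤ[X] :=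
  X ^ (2 * m) + (C ((r : ℤ) ^ m) +
    ∑ j : Fin m, C (a j) * (X ^ (m + j) + C ((r : ℤ) ^ (j : ℕ)) * X ^ (m - j : ℕ)))

theorem degree_circleFactor_tail_lt {m : ℕ} (hm : 1 ≤ m) (r : ℕ) (a : Fin m → ℤ) :
    (C ((r : ℤ) ^ m) + ∑ j : Fin m, C (a j) *
      (X ^ (m + j) + C ((r : ℤ) ^ (j : ℕ)) * X ^ (m - j : ℕ)) : ℤ[X]).degree < (2 * m : ℕ) := by
  rw [← mem_degreeLT]
  have hX : ∀ (b : ℤ) (i : ℕ), i < 2 * m → C b * X ^ i ∈ degreeLT ℤ (2 * m) := by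
    intro b i hi
    rw [mem_degreeLT]
    exact (degree_C_mul_X_pow_le _ _).trans_lt (by exact_mod_cast hi)
  refine Submodule.add_mem _ ?_ (Submodule.sum_mem _ fun j _ => ?_)
  · simpa using hX ((r : ℤ) ^ m) 0 (by omega)
  · rw [mul_add, ← mul_assoc, ← C_mul]
    exact Submodule.add_mem _ (hX _ _ (by omega)) (hX _ _ (by omega))

theorem circleFactor_monic {m : ℕ} (hm : 1 ≤ m) (r : ℕ) (a : Fin m → ℤ) :
    (circleFactor m r a).Monic :=
  monic_X_pow_add (degree_circleFactor_tail_lt hm r a)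

theorem natDegree_circleFactor {m : ℕ} (hm : 1 ≤ m) (r : ℕ) (a : Fin m → ℤ) :
    (circleFactor m r a).natDegree = 2 * m := by
  apply natDegree_eq_of_degree_eq_some
  rw [circleFactor, degree_add_eq_left_of_degree_lt] <;> rw [degree_X_pow]
  exact degree_circleFactor_tail_lt hm r a

theorem circleFactor_injective (m r : ℕ) : Function.Injective (circleFactor m r) := by
  intro a a' h
  have key : ∀ (b : Fin m → ℤ) (i : Fin m), (circleFactor m r b).coeff (m + i) =
      if (i : ℕ) = 0 then 2 * b i else b i := by
    intro b i
    have hi := i.2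
    simp only [circleFactor, coeff_add, finsetSum_coeff, coeff_C_mul, coeff_X_pow, coeff_C]
    rw [if_neg (by omega), if_neg (by omega), zero_add, zero_add, Finset.sum_eq_single i]
    · split_ifs with h1 h2 h3 <;> first | omega | simp_all
      ring
    · intro j _ hj
      have hj' : (j : ℕ) ≠ i := fun h => hj (Fin.ext h)
      rw [if_neg (by omega), if_neg (by omega)]
      simp
    · simp
  ext i
  have := congrArg (fun p => p.coeff (m + i)) h
  simp only [key] at this
  split_ifs at this <;> omega

/-- On the circle `z = R * exp (θ * I)`, a self-reciprocal polynomial is `z ^ m` times a real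
trigonometric polynomial. -/
theorem aeval_circleFactor (m r : ℕ) (a : Fin m → ℤ) {R : ℝ} (hR : R ^ 2 = r) (θ : ℝ) :
    aeval (R * Complex.exp (θ * Complex.I)) (circleFactor m r a) =
      (R * Complex.exp (θ * Complex.I)) ^ m * ((2 * R ^ m * Real.cos (m * θ) +
        ∑ j : Fin m, (a j : ℝ) * (2 * R ^ (j : ℕ) * Real.cos (j * θ)) : ℝ) : ℂ) := by
  set z : ℂ := R * Complex.exp (θ * Complex.I) with hz
  set w : ℂ := R * Complex.exp (-θ * Complex.I) with hw
  -- `w` is the conjugate of `z`, so that `r ^ j * z ^ (m - j) = z ^ m * w ^ j`.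
  have hzw : z * w = r := by
    have : (R : ℂ) ^ 2 = r := by exact_mod_cast hR
    rw [hz, hw, ← this]
    have : Complex.exp (θ * Complex.I) * Complex.exp (-θ * Complex.I) = 1 := by
      rw [← Complex.exp_add]; simp
    linear_combination (R : ℂ) ^ 2 * this
  have hsum : ∀ j : ℕ, z ^ j + w ^ j = 2 * R ^ j * Complex.cos (j * θ) := by
    intro j
    rw [hz, hw, mul_pow, mul_pow, ← Complex.exp_nat_mul, ← Complex.exp_nat_mul, Complex.cos]
    rw [show (j : ℂ) * (θ * Complex.I) = j * θ * Complex.I by ring,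
      show (j : ℂ) * (-θ * Complex.I) = -(j * θ) * Complex.I by ring]
    ring
  simp only [circleFactor, map_add, map_sum, map_mul, map_pow, aeval_X, aeval_C]
  push_cast
  have hzwm : z ^ m * w ^ m = (r : ℂ) ^ m := by rw [← mul_pow, hzw]
  rw [← hsum, mul_add, mul_add, hzwm, Finset.mul_sum, ← pow_add, ← two_mul, add_assoc]
  congr 2
  · apply Finset.sum_congr rfl
    intro j _
    rw [← hsum]
    have h1 : z ^ m = z ^ (j : ℕ) * z ^ (m - j : ℕ) := by
      rw [← pow_add, Nat.add_sub_cancel' j.2.le]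
    have h2 : ((r : ℂ)) ^ (j : ℕ) = z ^ (j : ℕ) * w ^ (j : ℕ) := by rw [← hzw, mul_pow]
    simp only [eq_intCast]
    rw [h2, pow_add, h1]
    ring

/-- The trigonometric polynomial attached to a small perturbation of `X ^ (2 * m) + r ^ m` changes
sign `2 * m` times on the circle, so that all the roots lie on the circle. -/
theorem norm_eq_of_mem_complexRoots_circleFactor {m r : ℕ} (hm : 1 ≤ m) {R : ℝ} (hR0 : 0 < R)
    (hR : R ^ 2 = r) {a : Fin m → ℤ} (ha : a ∈ coeffBox m R) {z : ℂ}
    (hz : z ∈ complexRoots (circleFactor m r a)) : ‖z‖ = R := by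
  have hm0 : (0 : ℝ) < m := by exact_mod_cast hm
  have hpi := Real.pi_pos
  set T : ℝ → ℝ := fun θ => 2 * R ^ m * Real.cos (m * θ) +
        ∑ j : Fin m, (a j : ℝ) * (2 * R ^ (j : ℕ) * Real.cos (j * θ)) with hT
  have hcont : Continuous T := by fun_prop
  have herr : ∀ θ, |∑ j : Fin m, (a j : ℝ) * (2 * R ^ (j : ℕ) * Real.cos (j * θ))| <
      2 * R ^ m := by
    intro θ
    calc _ ≤ ∑ j : Fin m, |(a j : ℝ) * (2 * R ^ (j : ℕ) * Real.cos (j * θ))| :=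
          Finset.abs_sum_le_sum_abs _ _
      _ ≤ ∑ j : Fin m, 2 * (|(a j : ℝ)| * R ^ (j : ℕ)) := by
          apply Finset.sum_le_sum
          intro j _
          rw [abs_mul, abs_mul, abs_of_nonneg (by positivity : (0 : ℝ) ≤ 2 * R ^ (j : ℕ))]
          have := Real.abs_cos_le_one (j * θ)
          calc _ ≤ |(a j : ℝ)| * (2 * R ^ (j : ℕ) * 1) := by gcongr
            _ = _ := by ring
      _ = 2 * ∑ j : Fin m, |(a j : ℝ)| * R ^ (j : ℕ) := by rw [Finset.mul_sum]
      _ < _ := by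
          gcongr
          exact sum_abs_mul_pow_lt hR0 (abs_le_of_mem_coeffBox ha)
  have hsign : ∀ l : ℕ, 0 < (-1) ^ l * T (l * Real.pi / m) := by
    intro l
    have hcos : Real.cos (m * (l * Real.pi / m)) = (-1) ^ l := by
      rw [mul_div_cancel₀ _ hm0.ne', Real.cos_nat_mul_pi]
    have h1 := abs_lt.1 (herr (l * Real.pi / m))
    simp only [hT, hcos]
    rcases neg_one_pow_eq_or ℝ l with h | h <;> rw [h] <;> linarith [h1.1, h1.2]
  have hroot : ∀ l : ℕ, ∃ θ : ℝ, l * Real.pi / m < θ ∧ θ < (l + 1) * Real.pi / m ∧ T θ = 0 := by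
    intro l
    have hle : l * Real.pi / m ≤ (l + 1) * Real.pi / m := by gcongr; linarith
    have h1 := hsign l
    have h2 := hsign (l + 1)
    rw [pow_succ] at h2
    push_cast at h2
    have hc : Continuous fun θ => (-1 : ℝ) ^ l * T θ := by fun_prop
    obtain ⟨θ, hθ, h0⟩ := intermediate_value_Ioo' hle hc.continuousOn
      (show (0 : ℝ) ∈ Set.Ioo _ _ from ⟨by linarith, h1⟩)
    refine ⟨θ, hθ.1, hθ.2, ?_⟩
    exact (mul_eq_zero.1 h0).resolve_left (pow_ne_zero _ (by norm_num))
  choose θ hθ1 hθ2 hθ0 using hroot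
  have hinj : Set.InjOn (fun l : ℕ => (R : ℂ) * Complex.exp (θ l * Complex.I))
      (Finset.range (2 * m)) := by
    have key : ∀ l l' : ℕ, l < l' → l' < 2 * m →
        (R : ℂ) * Complex.exp (θ l * Complex.I) ≠ R * Complex.exp (θ l' * Complex.I) := by
      intro l l' hll hl' h
      have hlt : θ l < θ l' := by
        refine (hθ2 l).trans_le (le_trans ?_ (hθ1 l').le)
        gcongr
        exact_mod_cast hll
      have h0 : 0 < θ l := lt_of_le_of_lt (by positivity) (hθ1 l)
      have h2 : θ l' < 2 * Real.pi := by
        refine (hθ2 l').trans_le ?_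
        rw [div_le_iff₀ hm0]
        have : ((l' : ℝ) + 1) ≤ 2 * m := by exact_mod_cast hl'
        nlinarith
      have h3 := mul_left_cancel₀ (by exact_mod_cast hR0.ne') h
      obtain ⟨N, hN⟩ := Complex.exp_eq_exp_iff_exists_int.1 h3
      have h4 : θ l = θ l' + N * (2 * Real.pi) := by
        have := congrArg Complex.im hN
        simpa using this
      have h5 : (N : ℝ) < 0 := by nlinarith
      have h6 : (-1 : ℝ) < N := by nlinarith
      have h7 : N < 0 := by exact_mod_cast h5
      have h8 : -1 < N := by exact_mod_cast h6
      omega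
    intro l hl l' hl' h
    simp only [Finset.coe_range, Set.mem_Iio] at hl hl'
    rcases lt_trichotomy l l' with h1 | h1 | h1
    · exact absurd h (key l l' h1 hl')
    · exact h1
    · exact absurd h.symm (key l' l h1 hl)
  set S := (Finset.range (2 * m)).image fun l : ℕ => (R : ℂ) * Complex.exp (θ l * Complex.I)
    with hS
  have hmon := circleFactor_monic hm r a
  have hle : S.val ≤ complexRoots (circleFactor m r a) := by
    rw [Multiset.le_iff_subset S.nodup]
    intro x hx
    obtain ⟨l, _, rfl⟩ := Finset.mem_image.1 (Finset.mem_def.2 hx)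
    have h0 := hθ0 l
    simp only [hT] at h0
    rw [mem_complexRoots hmon, aeval_circleFactor m r a hR, h0]
    simp
  have hEq := Multiset.eq_of_le_of_card_le hle (by
    rw [card_complexRoots hmon, natDegree_circleFactor hm, Finset.card_val, hS,
      Finset.card_image_of_injOn hinj, Finset.card_range])
  rw [← hEq, ← Finset.mem_def] at hz
  obtain ⟨l, _, rfl⟩ := Finset.mem_image.1 hz
  rw [norm_mul, Complex.norm_exp_ofReal_mul_I, Complex.norm_real, Real.norm_eq_abs,
    abs_of_pos hR0, mul_one]

/-! ### The lower bounds -/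

theorem mul_mem_dominantSet {A h : ℤ[X]} (hA : A.Monic) (hh : h.Monic) {R : ℝ} {n k H : ℕ}
    (hk : k ≠ 0) (hAdeg : A.natDegree = k) (hn : k + h.natDegree = n)
    (hAR : ∀ z ∈ complexRoots A, ‖z‖ = R) (hhR : ∀ z ∈ complexRoots h, ‖z‖ < R)
    (hH : height (A * h) ≤ H) : A * h ∈ dominantSet n k H := by
  refine ⟨hA.mul hh, by rw [hA.natDegree_mul hh, hAdeg, hn], hH, ?_⟩
  rw [← hAdeg]
  exact numDominantRoots_mul_eq hA hh (by omega) hAR hhR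

theorem height_le_of_norm_le {f : ℤ[X]} (hf : f.Monic) {R : ℝ} (hR1 : 1 ≤ R) {H : ℕ}
    (hR : ∀ z ∈ complexRoots f, ‖z‖ ≤ R) (hH : 2 ^ f.natDegree * R ^ f.natDegree ≤ H) :
    height f ≤ H := by
  refine Finset.sup_le fun i _ => ?_
  have h1 : |(f.coeff i : ℝ)| ≤ H := by
    refine (abs_coeff_le_of_norm_le hf hR i).trans (le_trans ?_ hH)
    rw [mul_comm]
    gcongr
    · exact_mod_cast Nat.choose_le_two_pow _ i
    · omega
  rw [← Int.cast_abs, Int.abs_eq_natAbs] at h1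
  exact_mod_cast h1

/-- The polynomial `X ^ (n - k) * (X ^ k - 1)` has height one and `k` roots of maximal modulus. -/
theorem one_le_D {n k H : ℕ} (hk : 1 ≤ k) (hkn : k ≤ n) (hH : 1 ≤ H) : 1 ≤ D n k H := by
  refine (Set.ncard_pos (dominantSet_finite n k H)).2 ?_
  have hA : (X ^ k - 1 : ℤ[X]).Monic := monic_X_pow_sub_C 1 (by omega)
  have hAdeg : (X ^ k - 1 : ℤ[X]).natDegree = k := natDegree_X_pow_sub_C (n := k) (r := (1 : ℤ))
  refine ⟨(X ^ k - 1) * X ^ (n - k), mul_mem_dominantSet (R := 1) hA (monic_X_pow _) (by omega)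
    hAdeg (by rw [natDegree_X_pow]; omega) ?_ ?_ ?_⟩
  · intro z hz
    rw [mem_complexRoots hA] at hz
    simp only [map_sub, map_pow, aeval_X, map_one] at hz
    exact Complex.norm_eq_one_of_pow_eq_one (sub_eq_zero.1 hz) (by omega)
  · intro z hz
    rw [mem_complexRoots (monic_X_pow _)] at hz
    simp only [map_pow, aeval_X] at hz
    rw [eq_zero_of_pow_eq_zero hz]
    simp
  · refine (Finset.sup_le fun i _ => ?_).trans hH
    rw [sub_mul, one_mul, ← pow_add, coeff_sub, coeff_X_pow, coeff_X_pow]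
    split_ifs <;> simp

/-- Counting the products `L t * G * h`, where `G` is a circle factor of squared radius `r t` and
`h` has all its roots inside that circle. The factor `L t` accommodates a real root of modulus
`√(r t)` when `k` is odd. -/
theorem sum_le_D {n k m d e H : ℕ} (hm : 1 ≤ m) (hk : e + 2 * m = k) (hn : k + d = n)
    (T : Finset ℕ) (r : ℕ → ℕ) (L : ℕ → ℤ[X]) (hLm : ∀ t ∈ T, (L t).Monic)
    (hLd : ∀ t ∈ T, (L t).natDegree = e)
    (hLr : ∀ t ∈ T, ∀ z ∈ complexRoots (L t), ‖z‖ = √(r t))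
    (hr1 : ∀ t ∈ T, 1 ≤ r t) (hrinj : Set.InjOn r T)
    (hH : ∀ t ∈ T, 2 ^ n * √(r t) ^ n ≤ (H : ℝ)) :
    ∑ t ∈ T, (√(r t) / 2) ^ (m * (m + 1) / 2 + d * (d + 1) / 2) ≤ (D n k H : ℝ) := by
  set S : Finset (Σ _ : ℕ, (Fin m → ℤ) × (Fin d → ℤ)) :=
    T.sigma fun t => coeffBox m √(r t) ×ˢ coeffBox d √(r t) with hS
  set F : (Σ _ : ℕ, (Fin m → ℤ) × (Fin d → ℤ)) → ℤ[X] :=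
    fun s => (L s.1 * circleFactor m (r s.1) s.2.1) * monicOfCoeffs d s.2.2 with hF
  have hcard : ∑ t ∈ T, (√(r t) / 2) ^ (m * (m + 1) / 2 + d * (d + 1) / 2) ≤ (S.card : ℝ) := by
    rw [hS, Finset.card_sigma]
    push_cast
    apply Finset.sum_le_sum
    intro t _
    rw [Finset.card_product, pow_add]
    push_cast
    gcongr
    · exact pow_le_card_coeffBox m (Real.sqrt_nonneg _)
    · exact pow_le_card_coeffBox d (Real.sqrt_nonneg _)
  have hR : ∀ t ∈ T, 1 ≤ √(r t) := by
    intro t ht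
    rw [Real.one_le_sqrt]
    exact_mod_cast hr1 t ht
  have hmem : ∀ s ∈ S, s.1 ∈ T ∧ s.2.1 ∈ coeffBox m √(r s.1) ∧ s.2.2 ∈ coeffBox d √(r s.1) := by
    intro s hs
    simpa [hS] using hs
  have hAm : ∀ s ∈ S, (L s.1 * circleFactor m (r s.1) s.2.1).Monic := fun s hs =>
    (hLm _ (hmem s hs).1).mul (circleFactor_monic hm _ _)
  have hAdeg : ∀ s ∈ S, (L s.1 * circleFactor m (r s.1) s.2.1).natDegree = k := by
    intro s hs
    rw [(hLm _ (hmem s hs).1).natDegree_mul (circleFactor_monic hm _ _), hLd _ (hmem s hs).1,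
      natDegree_circleFactor hm, hk]
  have hAR : ∀ s ∈ S, ∀ z ∈ complexRoots (L s.1 * circleFactor m (r s.1) s.2.1),
      ‖z‖ = √(r s.1) := by
    intro s hs z hz
    obtain ⟨ht, ha, -⟩ := hmem s hs
    rw [complexRoots_mul (hLm _ ht) (circleFactor_monic hm _ _), Multiset.mem_add] at hz
    rcases hz with hz | hz
    · exact hLr _ ht z hz
    · exact norm_eq_of_mem_complexRoots_circleFactor hm (by linarith [hR _ ht])
        (Real.sq_sqrt (by positivity)) ha hz
  have hhm : ∀ s : Σ _ : ℕ, (Fin m → ℤ) × (Fin d → ℤ), (monicOfCoeffs d s.2.2).Monic := fun s =>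
    monicOfCoeffs_monic _ _
  have hhR : ∀ s ∈ S, ∀ z ∈ complexRoots (monicOfCoeffs d s.2.2), ‖z‖ < √(r s.1) := by
    intro s hs z hz
    obtain ⟨ht, -, hc⟩ := hmem s hs
    exact norm_lt_of_mem_complexRoots_monicOfCoeffs (by linarith [hR _ ht]) hc hz
  have hinj : Set.InjOn F S := by
    intro s hs s' hs' heq
    have hk0 : k ≠ 0 := by omega
    have h1 := house_mul_eq (hAm s hs) (hhm s) (by rw [hAdeg s hs]; exact hk0) (hAR s hs) (hhR s hs)
    have h2 := house_mul_eq (hAm s' hs') (hhm s') (by rw [hAdeg s' hs']; exact hk0)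
      (hAR s' hs') (hhR s' hs')
    have h3 : r s.1 = r s'.1 := by
      have h4 : √(r s.1 : ℝ) = √(r s'.1) := by
        rw [← h1, ← h2]
        exact congrArg (fun p => (house p : ℝ)) heq
      have := (Real.sqrt_inj (by positivity) (by positivity)).1 h4
      exact_mod_cast this
    have h4 : s.1 = s'.1 := hrinj (hmem s hs).1 (hmem s' hs').1 h3
    obtain ⟨t, a, c⟩ := s
    obtain ⟨t', a', c'⟩ := s'
    obtain rfl : t = t' := h4
    obtain ⟨h5, h6⟩ := circle_disc_factor_unique (hAm _ hs) (hhm _) (hAm _ hs') (hhm _)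
      (hAR ⟨t, a, c⟩ hs) (hhR ⟨t, a, c⟩ hs) (hAR ⟨t, a', c'⟩ hs') (hhR ⟨t, a', c'⟩ hs') heq
    have h7 := circleFactor_injective m _ (mul_left_cancel₀ (hLm t (hmem _ hs).1).ne_zero h5)
    have h8 : c = c' := monicOfCoeffs_injective d h6
    obtain rfl : a = a' := h7
    rw [h8]
  have hsub : F '' S ⊆ dominantSet n k H := by
    rintro _ ⟨s, hs, rfl⟩
    refine mul_mem_dominantSet (hAm s hs) (hhm s) (by omega) (hAdeg s hs)
      (by rw [natDegree_monicOfCoeffs, hn]) (hAR s hs) (hhR s hs) ?_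
    have hdeg : (F s).natDegree = n := by
      rw [hF, (hAm s hs).natDegree_mul (hhm s), hAdeg s hs, natDegree_monicOfCoeffs, hn]
    refine height_le_of_norm_le ((hAm s hs).mul (hhm s)) (hR _ (hmem s hs).1) ?_ ?_
    · intro z hz
      rw [complexRoots_mul (hAm s hs) (hhm s), Multiset.mem_add] at hz
      rcases hz with hz | hz
      · exact (hAR s hs z hz).le
      · exact (hhR s hs z hz).le
    · change 2 ^ (F s).natDegree * _ ^ (F s).natDegree ≤ (H : ℝ)
      rw [hdeg]
      exact hH _ (hmem s hs).1
  refine hcard.trans ?_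
  have := Set.ncard_le_ncard hsub (dominantSet_finite n k H)
  rw [hinj.ncard_image, Set.ncard_coe_finset] at this
  exact_mod_cast this

/-- An interval `[y / 4, y]` with `y ≥ 1` contains at least `y / 4` positive integers. -/
theorem div_four_le_card_filter {y : ℝ} (hy : 1 ≤ y) :
    y / 4 ≤ (((Finset.Icc 1 ⌊y⌋₊).filter fun t : ℕ => y / 4 ≤ t).card : ℝ) := by
  rcases lt_or_ge y 4 with h | h
  · have hpos : 1 ≤ ((Finset.Icc 1 ⌊y⌋₊).filter fun t : ℕ => y / 4 ≤ t).card := by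
      rw [Nat.one_le_iff_ne_zero, Finset.card_ne_zero]
      refine ⟨1, Finset.mem_filter.2 ⟨Finset.mem_Icc.2 ⟨le_rfl, Nat.le_floor (by simpa)⟩, ?_⟩⟩
      push_cast
      linarith
    have : (1 : ℝ) ≤ ((Finset.Icc 1 ⌊y⌋₊).filter fun t : ℕ => y / 4 ≤ t).card := by
      exact_mod_cast hpos
    linarith
  · have hsub : Finset.Icc ⌈y / 4⌉₊ ⌊y⌋₊ ⊆ (Finset.Icc 1 ⌊y⌋₊).filter fun t : ℕ => y / 4 ≤ t := by
      intro t ht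
      obtain ⟨h1, h2⟩ := Finset.mem_Icc.1 ht
      have h3 : y / 4 ≤ t := Nat.ceil_le.1 h1
      refine Finset.mem_filter.2 ⟨Finset.mem_Icc.2 ⟨?_, h2⟩, h3⟩
      have : (1 : ℝ) ≤ t := by linarith
      exact_mod_cast this
    have h1 := Finset.card_le_card hsub
    rw [Nat.card_Icc] at h1
    have h2 : (⌊y⌋₊ + 1 : ℝ) ≤
        (((Finset.Icc 1 ⌊y⌋₊).filter fun t : ℕ => y / 4 ≤ t).card : ℝ) + ⌈y / 4⌉₊ := by
      have : ⌊y⌋₊ + 1 ≤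
        ((Finset.Icc 1 ⌊y⌋₊).filter fun t : ℕ => y / 4 ≤ t).card + ⌈y / 4⌉₊ := by omega
      exact_mod_cast this
    have h3 := Nat.lt_floor_add_one y
    have h4 := Nat.ceil_lt_add_one (a := y / 4) (by linarith)
    linarith

/-- The form in which the lower bounds are used: it is enough to bound `D n k H` from below by a
power of `x = H ^ (1 / n) / 2` when `x ≥ 1`. -/
theorem exists_lower_bound {n k : ℕ} (hk : 1 ≤ k) (hkn : k ≤ n) (E : ℕ) {c : ℝ} (hc : 0 < c)
    (h : ∀ (H : ℕ) (x : ℝ), 1 ≤ x → (2 * x) ^ n = H → c * x ^ E ≤ D n k H) :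
    ∃ c' : ℝ, 0 < c' ∧ ∀ H : ℕ, 1 ≤ H → c' * (H : ℝ) ^ ((E : ℝ) / n) ≤ D n k H := by
  have hn0 : (n : ℝ) ≠ 0 := by
    have : n ≠ 0 := by omega
    exact_mod_cast this
  refine ⟨min c 1 / 2 ^ E, by positivity, fun H hH => ?_⟩
  set x : ℝ := (H : ℝ) ^ (1 / (n : ℝ)) / 2 with hx
  have hx0 : 0 < x := by
    have : (0 : ℝ) < H := by exact_mod_cast hH
    positivity
  have hxn : (2 * x) ^ n = H := by
    rw [hx, mul_div_cancel₀ _ (by norm_num), ← Real.rpow_natCast, ← Real.rpow_mul (by positivity),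
      one_div_mul_cancel hn0, Real.rpow_one]
  have hxE : (H : ℝ) ^ ((E : ℝ) / n) = 2 ^ E * x ^ E := by
    rw [← mul_pow, ← Real.rpow_natCast (2 * x) E, hx, mul_div_cancel₀ _ (by norm_num),
      ← Real.rpow_mul (by positivity)]
    congr 1
    ring
  rw [hxE, ← mul_assoc, div_mul_cancel₀ _ (by positivity)]
  rcases le_or_gt 1 x with h1 | h1
  · refine le_trans ?_ (h H x h1 hxn)
    gcongr
    exact min_le_left _ _
  · calc min c 1 * x ^ E ≤ 1 * 1 := by
          gcongr
          · exact min_le_right _ _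
          · exact pow_le_one₀ hx0.le h1.le
      _ = 1 := by norm_num
      _ ≤ _ := by exact_mod_cast one_le_D hk hkn hH

/-- Here the squared radius runs over the integers `t` between `x ^ 2 / 4` and `x ^ 2`, where
`x = H ^ (1 / n) / 2`. -/
theorem lower_bound_even {n m d : ℕ} (hm : 1 ≤ m) (hn : 2 * m + d = n) :
    ∃ c : ℝ, 0 < c ∧ ∀ H : ℕ, 1 ≤ H →
      c * (H : ℝ) ^ (((m * (m + 1) / 2 + d * (d + 1) / 2 + 2 : ℕ) : ℝ) / n) ≤ D n (2 * m) H := by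
  set E := m * (m + 1) / 2 + d * (d + 1) / 2 with hE
  refine exists_lower_bound (by omega) (by omega) (E + 2) (c := (1 / 4) ^ (E + 1)) (by positivity)
    fun H x hx hH => ?_
  set T := (Finset.Icc 1 ⌊x ^ 2⌋₊).filter fun t : ℕ => x ^ 2 / 4 ≤ t with hT
  have hcard := div_four_le_card_filter (y := x ^ 2) (by nlinarith)
  have hx0 : 0 < x := by linarith
  have h := sum_le_D (e := 0) (k := 2 * m) (H := H) hm (by omega) hn T (fun t => t) (fun _ => 1)
    (fun _ _ => monic_one) (fun _ _ => natDegree_one) (by simp [complexRoots])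
    (fun t ht => (Finset.mem_Icc.1 (Finset.mem_filter.1 ht).1).1) (fun _ _ _ _ h => h) ?_
  · refine le_trans ?_ h
    calc (1 / 4) ^ (E + 1) * x ^ (E + 2) = x ^ 2 / 4 * (x / 4) ^ E := by
          rw [one_div_pow, div_pow x, pow_succ 4]; ring
      _ ≤ T.card * (x / 4) ^ E := by gcongr
      _ = ∑ t ∈ T, (x / 4) ^ E := by simp
      _ ≤ _ := by
        apply Finset.sum_le_sum
        intro t ht
        have h1 : x / 2 ≤ √t := by
          apply Real.le_sqrt_of_sq_le
          have := (Finset.mem_filter.1 ht).2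
          linarith
        exact pow_le_pow_left₀ (by positivity) (by linarith) _
  · intro t ht
    rw [← hH, mul_pow]
    gcongr
    rw [Real.sqrt_le_left hx0.le]
    exact (Nat.le_floor_iff (by positivity)).1 (Finset.mem_Icc.1 (Finset.mem_filter.1 ht).1).2

/-- Here the radius itself runs over the integers `t` between `x / 4` and `x`, where
`x = H ^ (1 / n) / 2`. -/
theorem lower_bound_odd {n m d : ℕ} (hm : 1 ≤ m) (hn : 2 * m + 1 + d = n) :
    ∃ c : ℝ, 0 < c ∧ ∀ H : ℕ, 1 ≤ H →
      c * (H : ℝ) ^ (((m * (m + 1) / 2 + d * (d + 1) / 2 + 1 : ℕ) : ℝ) / n) ≤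
        D n (2 * m + 1) H := by
  set E := m * (m + 1) / 2 + d * (d + 1) / 2 with hE
  refine exists_lower_bound (by omega) (by omega) (E + 1) (c := 1 / 4 * (1 / 8) ^ E)
    (by positivity) fun H x hx hH => ?_
  set T := (Finset.Icc 1 ⌊x⌋₊).filter fun t : ℕ => x / 4 ≤ t with hT
  have hcard := div_four_le_card_filter hx
  have hx0 : 0 < x := by linarith
  have hsqrt : ∀ t : ℕ, √((t ^ 2 : ℕ) : ℝ) = t := by
    intro t
    push_cast
    exact Real.sqrt_sq (by positivity)
  have h := sum_le_D (e := 1) (k := 2 * m + 1) (H := H) hm (by omega) hn T (fun t => t ^ 2)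
    (fun t => X - C (t : ℤ)) (fun _ _ => monic_X_sub_C _) (fun _ _ => natDegree_X_sub_C _) ?_
    (fun t ht => Nat.one_le_pow _ _ (Finset.mem_Icc.1 (Finset.mem_filter.1 ht).1).1)
    (fun a _ b _ h => Nat.pow_left_injective (n := 2) (by norm_num) h) ?_
  · refine le_trans ?_ h
    calc 1 / 4 * (1 / 8) ^ E * x ^ (E + 1) = x / 4 * (x / 8) ^ E := by
          rw [one_div_pow, div_pow x]; ring
      _ ≤ T.card * (x / 8) ^ E := by gcongr
      _ = ∑ t ∈ T, (x / 8) ^ E := by simp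
      _ ≤ _ := by
        apply Finset.sum_le_sum
        intro t ht
        rw [hsqrt]
        have := (Finset.mem_filter.1 ht).2
        exact pow_le_pow_left₀ (by positivity) (by linarith) _
  · intro t _ z hz
    rw [mem_complexRoots (monic_X_sub_C _)] at hz
    simp only [map_sub, aeval_X, aeval_C] at hz
    rw [hsqrt, sub_eq_zero.1 hz]
    simp
  · intro t ht
    rw [← hH, mul_pow, hsqrt]
    gcongr
    exact (Nat.le_floor_iff (by positivity)).1 (Finset.mem_Icc.1 (Finset.mem_filter.1 ht).1).2

/-! ### Counting coefficient vectors -/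

theorem eq_of_coeff_eq {n : ℕ} {f g : ℤ[X]} (hf : f.Monic) (hg : g.Monic) (hfn : f.natDegree = n)
    (hgn : g.natDegree = n) (h : ∀ i < n, f.coeff i = g.coeff i) : f = g := by
  ext i
  rcases lt_trichotomy i n with hi | rfl | hi
  · exact h i hi
  · rw [← hfn, hf.coeff_natDegree, hfn, ← hgn, hg.coeff_natDegree]
  · rw [coeff_eq_zero_of_natDegree_lt (by omega), coeff_eq_zero_of_natDegree_lt (by omega)]

/-- The exponent of `H` in the bound for the coefficient of `X ^ i`. -/
noncomputable def coeffExponent (n k i : ℕ) : ℝ := (min (n - i) k : ℕ) / (k : ℝ)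

theorem coeffExponent_nonneg (n k i : ℕ) : 0 ≤ coeffExponent n k i := by
  unfold coeffExponent
  positivity

theorem coeffExponent_eq_one {n k i : ℕ} (hk : 1 ≤ k) (hi : i + k ≤ n) :
    coeffExponent n k i = 1 := by
  rw [coeffExponent, min_eq_right (by omega), div_self]
  have : k ≠ 0 := by omega
  exact_mod_cast this

theorem sum_coeffExponent {n k : ℕ} (hk : 1 ≤ k) (hkn : k ≤ n) :
    ∑ i ∈ Finset.range n, coeffExponent n k i = n - ((k : ℝ) - 1) / 2 := by
  have hk0 : (k : ℝ) ≠ 0 := by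
    have : k ≠ 0 := by omega
    exact_mod_cast this
  have h1 : ∀ d : ℕ, d ≤ k → ∑ j ∈ Finset.range d, (min (j + 1) k : ℕ) / (k : ℝ) =
      d * (d + 1) / (2 * k) := by
    intro d hd
    induction d with
    | zero => simp
    | succ d ih =>
      rw [Finset.sum_range_succ, ih (by omega), min_eq_left hd]
      push_cast
      field_simp
      ring
  have h2 : ∑ j ∈ Finset.range n, (min (j + 1) k : ℕ) / (k : ℝ) = n - ((k : ℝ) - 1) / 2 := by
    induction n, hkn using Nat.le_induction with
    | base =>
      rw [h1 k le_rfl]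
      field_simp
      ring
    | succ n hn ih =>
      rw [Finset.sum_range_succ, ih, min_eq_right (by omega), div_self hk0]
      push_cast
      ring
  rw [← h2, ← Finset.sum_range_reflect]
  refine Finset.sum_congr rfl fun j hj => ?_
  have := Finset.mem_range.1 hj
  rw [coeffExponent, show n - (n - 1 - j) = j + 1 by omega]

/-- The coefficients of `X ^ s, …, X ^ (s + N - 1)`. -/
def coeffWindow (s N : ℕ) (f : ℤ[X]) : Fin N → ℤ := fun i => f.coeff (s + i)

/-- The box that contains the coefficients of index at least `s` of the counted polynomials. -/
noncomputable def windowBox (n k H s N : ℕ) : Finset (Fin N → ℤ) :=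
  intBox fun i : Fin N => (2 ^ n * (n + 1) : ℝ) * (H : ℝ) ^ coeffExponent n k (s + i)

theorem coeffWindow_mem_windowBox {n k H : ℕ} (hk : 1 ≤ k) (hH : 1 ≤ H) {f : ℤ[X]}
    (hf : f ∈ dominantSet n k H) (s N : ℕ) : coeffWindow s N f ∈ windowBox n k H s N :=
  mem_intBox.2 fun i => abs_coeff_le_rpow hk hH hf (s + i)

theorem card_windowBox_le (n k s N : ℕ) : ∃ C : ℝ, 0 < C ∧ ∀ H : ℕ, 1 ≤ H →
    ((windowBox n k H s N).card : ℝ) ≤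
      C * (H : ℝ) ^ (∑ i ∈ Finset.range N, coeffExponent n k (s + i)) := by
  refine ⟨(3 * (2 ^ n * (n + 1) : ℝ)) ^ N, by positivity, fun H hH => ?_⟩
  have hH1 : (1 : ℝ) ≤ H := by exact_mod_cast hH
  refine (card_intBox_le fun i => ?_).trans_eq ?_
  · have h1 : (1 : ℝ) ≤ 2 ^ n := one_le_pow₀ (by norm_num)
    have h2 : (1 : ℝ) ≤ n + 1 := by
      have : (0 : ℝ) ≤ n := by positivity
      linarith
    exact one_le_mul_of_one_le_of_one_le (one_le_mul_of_one_le_of_one_le h1 h2)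
      (Real.one_le_rpow hH1 (coeffExponent_nonneg _ _ _))
  · rw [← Fin.sum_univ_eq_sum_range (fun i => coeffExponent n k (s + i)) N,
      Real.rpow_sum_of_pos (by linarith)]
    simp_rw [← mul_assoc]
    rw [Finset.prod_mul_distrib]
    simp

/-- The counted polynomials whose coefficients of index at least `s` are prescribed. -/
def windowFiber (n k H s N : ℕ) (u : Fin N → ℤ) : Set ℤ[X] :=
  {f | f ∈ dominantSet n k H ∧ coeffWindow s N f = u}

theorem windowFiber_finite (n k H s N : ℕ) (u : Fin N → ℤ) : (windowFiber n k H s N u).Finite :=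
  (dominantSet_finite n k H).subset fun _ hf => hf.1

theorem D_le_sum_fiber {n k H : ℕ} (hk : 1 ≤ k) (hH : 1 ≤ H) (s N : ℕ) :
    D n k H ≤ ∑ u ∈ windowBox n k H s N, (windowFiber n k H s N u).ncard := by
  classical
  have hfin := dominantSet_finite n k H
  rw [D, Set.ncard_eq_toFinset_card _ hfin,
    Finset.card_eq_sum_card_fiberwise (f := coeffWindow s N) (t := windowBox n k H s N)]
  · refine Finset.sum_le_sum fun u _ => ?_
    rw [← Set.ncard_coe_finset]
    refine Set.ncard_le_ncard ?_ (windowFiber_finite _ _ _ _ _ _)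
    intro f hf
    simpa [windowFiber] using hf
  · intro f hf
    exact coeffWindow_mem_windowBox hk hH (by simpa using hf) s N

theorem eq_of_mem_windowFiber {n k H s N : ℕ} (hN : s + N = n) {u : Fin N → ℤ} {f g : ℤ[X]}
    (hf : f ∈ windowFiber n k H s N u) (hg : g ∈ windowFiber n k H s N u)
    (h : ∀ i < s, f.coeff i = g.coeff i) : f = g := by
  refine eq_of_coeff_eq hf.1.1 hg.1.1 hf.1.2.1 hg.1.2.1 fun i hi => ?_
  rcases lt_or_ge i s with his | his
  · exact h i his
  · have := congrFun (hf.2.trans hg.2.symm) ⟨i - s, by omega⟩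
    simp only [coeffWindow] at this
    rwa [Nat.add_sub_cancel' his] at this

/-- The bound given by the coefficient box alone; the parity of `k` plays no role. -/
theorem upper_bound_even {n k : ℕ} (hk : 1 ≤ k) (hkn : k ≤ n) : ∃ C : ℝ, 0 < C ∧ ∀ H : ℕ, 1 ≤ H →
    (D n k H : ℝ) ≤ C * (H : ℝ) ^ ((n : ℝ) - ((k : ℝ) - 1) / 2) := by
  obtain ⟨C, hC, h⟩ := card_windowBox_le n k 0 n
  refine ⟨C, hC, fun H hH => ?_⟩
  have h1 := h H hH
  simp only [zero_add] at h1
  rw [sum_coeffExponent hk hkn] at h1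
  refine le_trans ?_ h1
  have h2 : D n k H ≤ (windowBox n k H 0 n).card := by
    refine (D_le_sum_fiber hk hH 0 n).trans ?_
    rw [Finset.card_eq_sum_ones]
    refine Finset.sum_le_sum fun u _ => ?_
    rw [Set.ncard_le_one (windowFiber_finite _ _ _ _ _ _)]
    intro f hf g hg
    exact eq_of_mem_windowFiber (by simp) hf hg (by simp)
  exact_mod_cast h2

/-- If each choice of the coefficients of index at least two leaves `O(H)` polynomials, then one
power of `H` is saved over the count of the box. -/
theorem upper_bound_of_fiber_le {n k : ℕ} (hk : 1 ≤ k) (hkn : k + 1 ≤ n) (M : ℕ)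
    (hM : ∀ H : ℕ, 1 ≤ H → ∀ u : Fin (n - 2) → ℤ, (windowFiber n k H 2 (n - 2) u).ncard ≤ M * H) :
    ∃ C : ℝ, 0 < C ∧ ∀ H : ℕ, 1 ≤ H →
      (D n k H : ℝ) ≤ C * (H : ℝ) ^ ((n : ℝ) - ((k : ℝ) + 1) / 2) := by
  obtain ⟨C, hC, h⟩ := card_windowBox_le n k 2 (n - 2)
  have hsum : ∑ i ∈ Finset.range (n - 2), coeffExponent n k (2 + i) =
      (n : ℝ) - ((k : ℝ) + 1) / 2 - 1 := by
    have h1 := sum_coeffExponent hk (by omega : k ≤ n)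
    obtain ⟨N, rfl⟩ : ∃ N, n = N + 2 := ⟨n - 2, by omega⟩
    rw [Finset.sum_range_succ', Finset.sum_range_succ', coeffExponent_eq_one hk (by omega),
      coeffExponent_eq_one hk (by omega)] at h1
    simp_rw [add_assoc, show 1 + 1 = 2 from rfl] at h1
    simp only [Nat.add_sub_cancel, add_comm 2]
    linarith
  refine ⟨(M + 1) * C, by positivity, fun H hH => ?_⟩
  have hH0 : (0 : ℝ) < H := by exact_mod_cast hH
  have h1 := h H hH
  rw [hsum, Real.rpow_sub_one hH0.ne'] at h1
  have h2 : D n k H ≤ (windowBox n k H 2 (n - 2)).card * (M * H) := by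
    refine (D_le_sum_fiber hk hH 2 (n - 2)).trans ?_
    rw [← smul_eq_mul, ← Finset.sum_const]
    exact Finset.sum_le_sum fun u _ => hM H hH u
  have h3 : (D n k H : ℝ) ≤ (windowBox n k H 2 (n - 2)).card * (M * H) := by exact_mod_cast h2
  calc (D n k H : ℝ) ≤ _ := h3
    _ ≤ (C * ((H : ℝ) ^ ((n : ℝ) - ((k : ℝ) + 1) / 2) / H)) * ((M + 1) * H) := by
        gcongr
        linarith
    _ = _ := by
        field_simp

/-! ### Polynomials with all roots of the same modulus -/

/-- If all the roots of `f` have modulus `R`, then `R ^ 2 / α` is the complex conjugate of `α` for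
each root `α`, so that `f` is self-reciprocal up to scaling. -/
theorem norm_coeff_symm (s : Multiset ℂ) {R : ℝ} (hs : ∀ z ∈ s, ‖z‖ = R) {i : ℕ}
    (hi : i ≤ s.card) :
    ‖(s.map fun z => X - C z).prod.coeff (s.card - i)‖ * R ^ (2 * (s.card - i)) =
      R ^ s.card * ‖(s.map fun z => X - C z).prod.coeff i‖ := by
  have key : ∀ t : Multiset ℂ, (∀ z ∈ t, ‖z‖ = R) → ∃ c : ℂ, ‖c‖ = R ^ t.card ∧
      reflect t.card ((t.map fun z => X - C z).prod.comp (C ((R : ℂ) ^ 2) * X)) =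
        C c * ((t.map fun z => X - C z).prod).map (starRingEnd ℂ) := by
    intro t
    induction t using Multiset.induction_on with
    | empty => exact fun _ => ⟨1, by simp⟩
    | cons a t ih =>
      intro ht
      obtain ⟨c, hc, h⟩ := ih fun z hz => ht z (Multiset.mem_cons_of_mem hz)
      have ha : ‖a‖ = R := ht a (Multiset.mem_cons_self a t)
      refine ⟨-a * c, by rw [norm_mul, norm_neg, ha, hc, Multiset.card_cons, pow_succ]; ring, ?_⟩
      have hd : ((t.map fun z => X - C z).prod.comp (C ((R : ℂ) ^ 2) * X)).natDegree ≤ t.card := by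
        refine natDegree_comp_le.trans ?_
        rw [natDegree_multiset_prod_X_sub_C_eq_card]
        calc _ ≤ t.card * 1 := by gcongr; exact (natDegree_C_mul_le _ _).trans natDegree_X_le
          _ = _ := mul_one _
      have hd1 : (C ((R : ℂ) ^ 2) * X - C a).natDegree ≤ 1 := by
        compute_degree
      have haa : a * (starRingEnd ℂ) a = (R : ℂ) ^ 2 := by
        rw [Complex.mul_conj, Complex.normSq_eq_norm_sq, ha]
        push_cast
        rfl
      have hrefl : reflect 1 (C ((R : ℂ) ^ 2) * X - C a) = C (-a) * (X - C ((starRingEnd ℂ) a)) := by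
        have h1 : C ((R : ℂ) ^ 2) * X - C a = C ((R : ℂ) ^ 2) * X ^ 1 + C (-a) * X ^ 0 := by
          simp [sub_eq_add_neg]
        rw [h1, reflect_add, reflect_C_mul_X_pow, reflect_C_mul_X_pow, ← haa]
        rw [revAt_le le_rfl, revAt_le zero_le_one]
        simp
        ring
      rw [Multiset.map_cons, Multiset.prod_cons, Multiset.card_cons, mul_comp, add_comm t.card 1,
        sub_comp, X_comp, C_comp, reflect_mul _ _ hd1 hd, h, hrefl, Polynomial.map_mul]
      simp only [Polynomial.map_sub, map_X, map_C, C_mul]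
      ring
  obtain ⟨c, hc, h⟩ := key s hs
  have h1 := congrArg (fun p => ‖p.coeff i‖) h
  simp only [coeff_reflect, coeff_C_mul, coeff_map, norm_mul, hc, RCLike.norm_conj,
    comp_C_mul_X_coeff, norm_pow, revAt_le hi] at h1
  rw [← h1, ← pow_mul, Complex.norm_real, ← norm_pow]
  congr 1
  rw [norm_pow, pow_mul, pow_mul, Real.norm_eq_abs, sq_abs]

theorem norm_eq_house_of_mem_dominantSet_self {n H : ℕ} {f : ℤ[X]} (hf : f ∈ dominantSet n n H) :
    ∀ z ∈ complexRoots f, ‖z‖ = house f := by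
  classical
  obtain ⟨hmon, hdeg, -, hnum⟩ := hf
  have h1 : (complexRoots f).countP (fun z => ‖z‖₊ = house f) = (complexRoots f).card := by
    rw [card_complexRoots hmon, hdeg, ← hnum, numDominantRoots]
  intro z hz
  have := Multiset.countP_eq_card.1 h1 z hz
  rw [← this, coe_nnnorm]

theorem abs_coeff_symm {n H : ℕ} {f : ℤ[X]} (hf : f ∈ dominantSet n n H) {i : ℕ} (hi : i ≤ n) :
    |(f.coeff (n - i) : ℝ)| * (house f : ℝ) ^ (2 * (n - i)) =
      (house f : ℝ) ^ n * |(f.coeff i : ℝ)| := by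
  have hcard : (complexRoots f).card = n := by rw [card_complexRoots hf.1, hf.2.1]
  have := norm_coeff_symm (complexRoots f) (norm_eq_house_of_mem_dominantSet_self hf) (i := i) (by omega)
  rw [← map_eq_prod_complexRoots hf.1, hcard] at this
  simpa only [coeff_map, eq_intCast, Complex.norm_intCast] using this

theorem abs_coeff_zero_eq {n H : ℕ} {f : ℤ[X]} (hf : f ∈ dominantSet n n H) :
    |(f.coeff 0 : ℝ)| = (house f : ℝ) ^ n := by
  have h := abs_coeff_symm hf (le_refl n)
  have h1 : f.coeff n = 1 := by
    have := hf.1.coeff_natDegree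
    rwa [hf.2.1] at this
  simpa [h1] using h

/-- For odd `n`, if all the roots have the same modulus, then a nonzero middle coefficient
determines the modulus. -/
theorem house_eq_of_coeffWindow_eq {n H : ℕ} (hn : Odd n) {f g : ℤ[X]}
    (hf : f ∈ dominantSet n n H) (hg : g ∈ dominantSet n n H) {i : ℕ} (hin : i < n)
    (hi : f.coeff i = g.coeff i) (hi' : f.coeff (n - i) = g.coeff (n - i)) (hne : f.coeff i ≠ 0) :
    house f = house g := by
  have hpos : ∀ {p : ℤ[X]}, p ∈ dominantSet n n H → p.coeff i ≠ 0 → (0 : ℝ) < house p := by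
    intro p hp hpne
    by_contra! hle
    have h0 : (house p : ℝ) = 0 := le_antisymm hle (by positivity)
    have h1 := abs_coeff_le_of_norm_le hp.1 (fun z hz => norm_le_house hz) i
    rw [h0, hp.2.1, zero_pow (by omega), zero_mul] at h1
    exact hpne (by exact_mod_cast abs_nonpos_iff.1 h1)
  have hf0 := hpos hf hne
  have hg0 := hpos hg (hi ▸ hne)
  have h1 := abs_coeff_symm hf hin.le
  have h2 := abs_coeff_symm hg hin.le
  rw [← hi, ← hi'] at h2
  set x : ℝ := (house f : ℝ) with hx
  set y : ℝ := (house g : ℝ) with hy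
  set B : ℝ := |(f.coeff (n - i) : ℝ)|
  set A : ℝ := |(f.coeff i : ℝ)| with hA
  have hA0 : 0 < A := abs_pos.2 (by exact_mod_cast hne)
  have hB0 : B ≠ 0 := by
    intro h0
    rw [h0, zero_mul] at h1
    have : 0 < x ^ n * A := by positivity
    linarith
  have h3 : (y / x) ^ (2 * (n - i)) = (y / x) ^ n := by
    rw [div_pow, div_pow, div_eq_div_iff (by positivity) (by positivity)]
    have h4 : B * A * (y ^ (2 * (n - i)) * x ^ n) = B * A * (y ^ n * x ^ (2 * (n - i))) := by
      linear_combination (A * x ^ n) * h2 - (A * y ^ n) * h1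
    exact mul_left_cancel₀ (mul_ne_zero hB0 hA0.ne') h4
  have h5 : y / x = 1 := by
    by_contra hne1
    have := pow_right_injective₀ (by positivity) hne1 h3
    obtain ⟨m, hm⟩ := hn
    omega
  have h6 : y = x := by rwa [div_eq_one_iff_eq hf0.ne'] at h5
  rw [← NNReal.coe_inj, ← hx, ← hy, h6]

/-- All roots have modulus `R` and `|f(0)| = R ^ n`. If some middle coefficient is nonzero, the
coefficients of index at least one leave at most two choices for `f(0)`; the remaining polynomials
`X ^ n + a` contribute `O(H)`. -/
theorem upper_bound_odd_self {n : ℕ} (hn : Odd n) (hn3 : 3 ≤ n) : ∃ C : ℝ, 0 < C ∧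
    ∀ H : ℕ, 1 ≤ H → (D n n H : ℝ) ≤ C * (H : ℝ) ^ ((n : ℝ) - ((n : ℝ) + 1) / 2) := by
  obtain ⟨C, hC, h⟩ := card_windowBox_le n n 1 (n - 1)
  have hsum : ∑ i ∈ Finset.range (n - 1), coeffExponent n n (1 + i) =
      (n : ℝ) - ((n : ℝ) + 1) / 2 := by
    have h1 := sum_coeffExponent (by omega : 1 ≤ n) le_rfl
    obtain ⟨N, rfl⟩ : ∃ N, n = N + 1 := ⟨n - 1, by omega⟩
    rw [Finset.sum_range_succ', coeffExponent_eq_one (by omega) (by omega)] at h1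
    simp only [Nat.add_sub_cancel, add_comm 1]
    linarith
  refine ⟨3 + 2 * C, by positivity, fun H hH => ?_⟩
  have hH1 : (1 : ℝ) ≤ H := by exact_mod_cast hH
  have h1 := h H hH
  rw [hsum] at h1
  have hzero : (windowFiber n n H 1 (n - 1) 0).ncard ≤ 3 * H := by
    have h2 : (windowFiber n n H 1 (n - 1) 0).ncard ≤ (Finset.Icc (-(H : ℤ)) H : Set ℤ).ncard := by
      refine Set.ncard_le_ncard_of_injOn (fun f => f.coeff 0) ?_ ?_ (Set.toFinite _)
      · intro f hf
        have := (natAbs_coeff_le_height f 0).trans hf.1.2.2.1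
        simp only [Finset.coe_Icc, Set.mem_Icc]
        omega
      · intro f hf g hg hfg
        refine eq_of_mem_windowFiber (by omega) hf hg fun i hi => ?_
        obtain rfl : i = 0 := by omega
        exact hfg
    rw [Set.ncard_coe_finset, Int.card_Icc] at h2
    omega
  have hne : ∀ u ≠ 0, (windowFiber n n H 1 (n - 1) u).ncard ≤ 2 := by
    intro u hu
    rcases (windowFiber n n H 1 (n - 1) u).eq_empty_or_nonempty with he | ⟨g, hg⟩
    · simp [he]
    obtain ⟨j, hj⟩ := Function.ne_iff.1 hu
    have hj2 := j.2
    have hgj : g.coeff (1 + j) = u j := congrFun hg.2 j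
    have h2 : (windowFiber n n H 1 (n - 1) u).ncard ≤ ({g.coeff 0, -g.coeff 0} : Set ℤ).ncard := by
      refine Set.ncard_le_ncard_of_injOn (fun f => f.coeff 0) ?_ ?_ (Set.toFinite _)
      · intro f hf
        have hcoe : ∀ i, 1 ≤ i → i < n → f.coeff i = g.coeff i := by
          intro i h1 h2
          have := congrFun (hf.2.trans hg.2.symm) ⟨i - 1, by omega⟩
          simp only [coeffWindow] at this
          rwa [Nat.add_sub_cancel' h1] at this
        have h3 : house f = house g :=
          house_eq_of_coeffWindow_eq hn hf.1 hg.1 (i := 1 + j) (by omega)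
            (hcoe _ (by omega) (by omega)) (hcoe _ (by omega) (by omega))
            (by rw [hcoe _ (by omega) (by omega), hgj]; exact hj)
        have h4 : |(f.coeff 0 : ℝ)| = |(g.coeff 0 : ℝ)| := by
          rw [abs_coeff_zero_eq hf.1, abs_coeff_zero_eq hg.1, h3]
        have h5 : |f.coeff 0| = |g.coeff 0| := by exact_mod_cast h4
        simpa using abs_eq_abs.1 h5
      · intro f hf f' hf' hff
        refine eq_of_mem_windowFiber (by omega) hf hf' fun i hi => ?_
        obtain rfl : i = 0 := by omega
        exact hff
    exact h2.trans (Set.ncard_insert_le _ _ |>.trans (by simp))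
  have h2 : D n n H ≤ 3 * H + (windowBox n n H 1 (n - 1)).card * 2 := by
    refine (D_le_sum_fiber (by omega) hH 1 (n - 1)).trans ?_
    calc _ ≤ ∑ u ∈ windowBox n n H 1 (n - 1), ((if u = 0 then 3 * H else 0) + 2) := by
          refine Finset.sum_le_sum fun u _ => ?_
          split_ifs with hu
          · subst hu; omega
          · have := hne u hu; omega
      _ ≤ _ := by
          rw [Finset.sum_add_distrib, Finset.sum_const, smul_eq_mul, Finset.sum_ite_eq']
          gcongr
          split_ifs <;> omega
  have h3 : (D n n H : ℝ) ≤ 3 * H + (windowBox n n H 1 (n - 1)).card * 2 := by exact_mod_cast h2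
  have h4 : (H : ℝ) ≤ (H : ℝ) ^ ((n : ℝ) - ((n : ℝ) + 1) / 2) := by
    conv_lhs => rw [← Real.rpow_one (H : ℝ)]
    apply Real.rpow_le_rpow_of_exponent_le hH1
    have : (3 : ℝ) ≤ n := by exact_mod_cast hn3
    linarith
  linarith

/-! ### Multiplicative relations between roots -/

/-- The roots `z` are not pairwise distinct, or three distinct ones satisfy `x ^ 2 = y * w`. -/
def HasGeometricTriple {ι : Type*} (z : ι → ℂ) : Prop :=
  ¬ Function.Injective z ∨ ∃ p q r, p ≠ q ∧ p ≠ r ∧ q ≠ r ∧ z p ^ 2 = z q * z r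

/-- The symmetric polynomial whose vanishing at `z` expresses `HasGeometricTriple z`. -/
noncomputable def triplePoly (n : ℕ) : MvPolynomial (Fin n) ℂ :=
  (∏ p : Fin n × Fin n with p.1 ≠ p.2, (MvPolynomial.X p.1 - MvPolynomial.X p.2)) *
    ∏ p : Fin n × Fin n × Fin n with p.1 ≠ p.2.1 ∧ p.1 ≠ p.2.2 ∧ p.2.1 ≠ p.2.2,
      (MvPolynomial.X p.1 ^ 2 - MvPolynomial.X p.2.1 * MvPolynomial.X p.2.2)

theorem triplePoly_isSymmetric (n : ℕ) : (triplePoly n).IsSymmetric := by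
  intro e
  rw [triplePoly, map_mul, map_prod, map_prod]
  congr 1
  · refine Finset.prod_equiv (e.prodCongr e) ?_ ?_
    · simp
    · simp
  · refine Finset.prod_equiv (e.prodCongr (e.prodCongr e)) ?_ ?_
    · simp
    · simp

theorem eval_triplePoly_eq_zero_iff {n : ℕ} (z : Fin n → ℂ) :
    MvPolynomial.eval z (triplePoly n) = 0 ↔ HasGeometricTriple z := by
  rw [triplePoly, map_mul, map_prod, map_prod, mul_eq_zero, Finset.prod_eq_zero_iff,
    Finset.prod_eq_zero_iff, HasGeometricTriple, Function.not_injective_iff]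
  simp only [Finset.mem_filter, Finset.mem_univ, true_and, Prod.exists, map_sub, map_mul, map_pow,
    MvPolynomial.eval_X, sub_eq_zero, and_assoc, and_comm]

theorem coeff_prod_X_sub_C_fin {n : ℕ} (z : Fin n → ℂ) {i : ℕ} (hi : i ≤ n) :
    (∏ j, (X - C (z j))).coeff i =
      (-1) ^ (n - i) * MvPolynomial.eval z (MvPolynomial.esymm (Fin n) ℂ (n - i)) := by
  have h := Multiset.prod_X_sub_C_coeff (Finset.univ.val.map z) (k := i) (by simpa using hi)
  rw [Multiset.map_map] at h
  have h2 := MvPolynomial.aeval_esymm_eq_multiset_esymm (Fin n) ℂ (n - i) z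
  rw [MvPolynomial.aeval_eq_eval] at h2
  simp only [Multiset.card_map, Finset.card_val, Finset.card_univ, Fintype.card_fin] at h
  rw [← h2] at h
  exact h

/-- By the fundamental theorem of symmetric polynomials, `HasGeometricTriple` for the roots of a
monic polynomial is the vanishing of a fixed polynomial in the coefficients. -/
theorem exists_coeffPoly (n : ℕ) : ∃ Ψ : MvPolynomial (Fin n) ℂ, ∀ z : Fin n → ℂ,
    MvPolynomial.eval (fun i : Fin n => (∏ j, (X - C (z j))).coeff i) Ψ = 0 ↔
      HasGeometricTriple z := by
  obtain ⟨Q, hQ⟩ := MvPolynomial.esymmAlgHom_surjective (σ := Fin n) ℂ (n := n) (by simp)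
    ⟨triplePoly n, triplePoly_isSymmetric n⟩
  have hQ' : MvPolynomial.aeval (fun i : Fin n => MvPolynomial.esymm (Fin n) ℂ (i + 1)) Q =
      triplePoly n := by
    rw [← MvPolynomial.esymmAlgHom_apply, hQ]
  refine ⟨MvPolynomial.aeval
    (fun i : Fin n => MvPolynomial.C ((-1) ^ (i + 1 : ℕ)) * MvPolynomial.X (Fin.rev i)) Q,
    fun z => ?_⟩
  rw [← eval_triplePoly_eq_zero_iff, ← hQ']
  apply iff_of_eq
  congr 1
  rw [← MvPolynomial.aeval_eq_eval, ← MvPolynomial.aeval_eq_eval, ← AlgHom.comp_apply,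
    ← AlgHom.comp_apply, MvPolynomial.comp_aeval, MvPolynomial.comp_aeval]
  congr 2
  funext i
  simp only [MvPolynomial.aeval_eq_eval, map_mul, MvPolynomial.eval_C, MvPolynomial.eval_X]
  rw [coeff_prod_X_sub_C_fin z (by omega), Fin.val_rev,
    show n - (n - (↑i + 1)) = ↑i + 1 by omega, ← mul_assoc, ← mul_pow]
  simp

theorem exists_fin_map_eq {α : Type*} {n : ℕ} (s : Multiset α) (hs : s.card = n) :
    ∃ z : Fin n → α, Finset.univ.val.map z = s := by
  obtain ⟨l, rfl⟩ := Quot.exists_rep s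
  have hl : l.length = n := hs
  subst hl
  exact ⟨l.get, by rw [Fin.univ_val_map, List.ofFn_get]; rfl⟩

theorem exists_eq_prod_fin {n : ℕ} {f : ℂ[X]} (hf : f.Monic) (hn : f.natDegree = n) :
    ∃ z : Fin n → ℂ, f = ∏ j, (X - C (z j)) := by
  obtain ⟨z, hz⟩ := exists_fin_map_eq f.roots
    (by rw [splits_iff_card_roots.1 (IsAlgClosed.splits f), hn])
  refine ⟨z, ?_⟩
  rw [(IsAlgClosed.splits f).eq_prod_roots_of_monic hf, ← hz, Multiset.map_map]
  rfl

/-- The trinomial `X ^ n + X - 1` has distinct roots and no relation `x ^ 2 = y * w`: with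
`x ^ n = 1 - x`, the relation gives `(1 - x) ^ 2 = (1 - y) * (1 - w)`, so that
`2 * x = y + w` and `y = w`. -/
theorem not_hasGeometricTriple_trinomial {n : ℕ} (hn : 2 ≤ n) {z : Fin n → ℂ}
    (hz : (X ^ n + X - 1 : ℂ[X]) = ∏ j, (X - C (z j))) : ¬ HasGeometricTriple z := by
  have hroot : ∀ j, z j ^ n = 1 - z j := by
    intro j
    have h := congrArg (eval (z j)) hz
    rw [eval_prod, Finset.prod_eq_zero (Finset.mem_univ j) (by simp)] at h
    simp only [eval_sub, eval_add, eval_pow, eval_X, eval_one] at h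
    linear_combination h
  have hinj : Function.Injective z := by
    intro p q hpq
    by_contra hne
    -- At a double root `x` one has `n * x ^ (n - 1) = -1`, whence `x = n / (n - 1) > 0`.
    obtain ⟨N, rfl⟩ : ∃ N, n = N + 2 := ⟨n - 2, by omega⟩
    have hdvd : (X - C (z p)) * (X - C (z p)) ∣ (X ^ (N + 2) + X - 1 : ℂ[X]) := by
      rw [hz, ← Finset.mul_prod_erase _ _ (Finset.mem_univ p)]
      apply mul_dvd_mul_left
      rw [hpq]
      exact Finset.dvd_prod_of_mem (fun j => X - C (z j))
        (Finset.mem_erase.2 ⟨Ne.symm hne, Finset.mem_univ q⟩)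
    obtain ⟨g, hg⟩ := hdvd
    have h1 := congrArg (fun P => eval (z p) (derivative P)) hg
    simp only [derivative_mul, derivative_add, derivative_sub, derivative_X_pow, derivative_X,
      derivative_C, derivative_one, eval_add, eval_sub, eval_mul, eval_X, eval_C, eval_pow,
      eval_one, eval_zero, sub_self, map_natCast, eval_natCast] at h1
    have h2 : ((N + 2 : ℕ) : ℂ) * z p ^ (N + 1) + 1 = 0 := by
      simpa using h1
    have h3 := hroot p
    have h4 : z p = (((N : ℝ) + 2) / (N + 1) : ℝ) := by
      have h5 : ((N : ℂ) + 1) ≠ 0 := by exact_mod_cast Nat.succ_ne_zero N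
      push_cast at h2 ⊢
      rw [eq_div_iff h5]
      linear_combination ((N : ℂ) + 2) * h3 - z p * h2
    rw [h4] at h2
    have h6 : ((N + 2 : ℕ) : ℝ) * (((N : ℝ) + 2) / (N + 1)) ^ (N + 1) + 1 = 0 := by
      exact_mod_cast h2
    have h7 : 0 ≤ ((N + 2 : ℕ) : ℝ) * (((N : ℝ) + 2) / (N + 1)) ^ (N + 1) := by positivity
    linarith
  rintro (h | ⟨p, q, r, hpq, hpr, hqr, h⟩)
  · exact h hinj
  · apply hqr
    apply hinj
    have h1 : (1 - z p) ^ 2 = (1 - z q) * (1 - z r) := by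
      rw [← hroot, ← hroot, ← hroot, ← mul_pow, ← h]
      ring
    have h2 : 2 * z p = z q + z r := by linear_combination h - h1
    have h3 : (z q - z r) ^ 2 = 0 := by
      linear_combination (-(2 * z p) - (z q + z r)) * h2 + 4 * h
    exact sub_eq_zero.1 (pow_eq_zero_iff (two_ne_zero)|>.1 h3)

theorem hasGeometricTriple_smul {ι : Type*} {z : ι → ℂ} {c : ℂ} (hc : c ≠ 0) :
    HasGeometricTriple (fun i => c * z i) ↔ HasGeometricTriple z := by
  have h1 : Function.Injective (fun i => c * z i) ↔ Function.Injective z :=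
    (mul_right_injective₀ hc).of_comp_iff z
  unfold HasGeometricTriple
  rw [h1]
  have h2 : ∀ p q r, (c * z p) ^ 2 = c * z q * (c * z r) ↔ z p ^ 2 = z q * z r := by
    intro p q r
    rw [show (c * z p) ^ 2 = c ^ 2 * z p ^ 2 by ring,
      show c * z q * (c * z r) = c ^ 2 * (z q * z r) by ring]
    exact mul_right_inj' (pow_ne_zero 2 hc)
  simp only [h2]

/-- Prescribing the coefficients of index at least two, and letting the two others vary, does not
make the polynomial of `exists_coeffPoly` vanish identically: rescaling the roots
deforms the polynomial to `X ^ n + X - 1`. -/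
theorem exists_eval_ne_zero {N : ℕ} {Ψ : MvPolynomial (Fin (N + 2)) ℂ}
    (hΨ : ∀ z : Fin (N + 2) → ℂ,
      MvPolynomial.eval (fun i : Fin (N + 2) => (∏ j, (X - C (z j))).coeff i) Ψ = 0 ↔
        HasGeometricTriple z) (u : Fin N → ℂ) :
    ∃ b a : ℂ, MvPolynomial.eval (Fin.cons b (Fin.cons a u : Fin (N + 1) → ℂ)) Ψ ≠ 0 := by
  set v : ℂ → Fin (N + 2) → ℂ := fun s =>
    Fin.cons (-1) (Fin.cons 1 fun i : Fin N => u i * s ^ (N - i : ℕ) : Fin (N + 1) → ℂ) with hv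
  have hcont : Continuous fun s => MvPolynomial.eval (v s) Ψ := by
    refine (MvPolynomial.continuous_eval Ψ).comp ?_
    refine continuous_pi fun i => ?_
    refine Fin.cases ?_ (fun i => Fin.cases ?_ (fun i => ?_) i) i
    · simp only [hv, Fin.cons_zero]; fun_prop
    · simp only [hv, Fin.cons_zero, Fin.cons_succ]; fun_prop
    · simp only [hv, Fin.cons_succ]; fun_prop
  have h0 : MvPolynomial.eval (v 0) Ψ ≠ 0 := by
    have htri : monicOfCoeffs (N + 2) (v 0) = X ^ (N + 2) + X - 1 := by
      rw [monicOfCoeffs, Fin.sum_univ_succ, Fin.sum_univ_succ]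
      have : ∀ i : Fin N, (0 : ℂ) ^ (N - i : ℕ) = 0 := fun i => zero_pow (by omega)
      simp [hv, this]
      ring
    obtain ⟨z, hz⟩ := exists_eq_prod_fin (monicOfCoeffs_monic (N + 2) (v 0))
      (natDegree_monicOfCoeffs _ _)
    have h1 := (hΨ z).not.2 (not_hasGeometricTriple_trinomial (by omega) (htri.symm.trans hz))
    rw [← hz] at h1
    simpa only [coeff_monicOfCoeffs] using h1
  obtain ⟨s, hs, hs0⟩ : ∃ s, MvPolynomial.eval (v s) Ψ ≠ 0 ∧ s ≠ 0 := by
    have h1 := (hcont.continuousAt.eventually_ne h0).filter_mono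
      (nhdsWithin_le_nhds (s := ({0}ᶜ : Set ℂ)))
    have h2 : ∀ᶠ s in nhdsWithin (0 : ℂ) {0}ᶜ, s ≠ 0 := eventually_mem_nhdsWithin
    exact (h1.and h2).exists
  obtain ⟨z, hz⟩ := exists_eq_prod_fin (monicOfCoeffs_monic (N + 2) (v s))
    (natDegree_monicOfCoeffs _ _)
  have h1 : ¬ HasGeometricTriple z := by
    rw [← hΨ z, ← hz]
    simpa only [coeff_monicOfCoeffs] using hs
  have h2 : ¬ HasGeometricTriple fun i => s⁻¹ * z i := by
    rwa [hasGeometricTriple_smul (inv_ne_zero hs0)]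
  rw [← hΨ] at h2
  have hcoeff : ∀ i : Fin (N + 2), (∏ j, (X - C (s⁻¹ * z j))).coeff i =
      v s i * (s ^ (N + 2 - i : ℕ))⁻¹ := by
    intro i
    have h3 : (∏ j, (X - C (z j))).comp (C s * X) =
        C (s ^ (N + 2)) * ∏ j, (X - C (s⁻¹ * z j)) := by
      rw [prod_comp]
      have : ∀ j, (X - C (z j)).comp (C s * X) = C s * (X - C (s⁻¹ * z j)) := by
        intro j
        rw [sub_comp, X_comp, C_comp, mul_sub, ← C_mul, mul_inv_cancel_left₀ hs0]
      simp_rw [this]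
      rw [Finset.prod_mul_distrib]
      simp
    have h4 := congrArg (fun p => p.coeff i) h3
    simp only [comp_C_mul_X_coeff, coeff_C_mul] at h4
    rw [← hz, coeff_monicOfCoeffs] at h4
    have h5 : s ^ (N + 2) = s ^ (i : ℕ) * s ^ (N + 2 - i : ℕ) := by
      rw [← pow_add, Nat.add_sub_cancel' i.2.le]
    have h6 := pow_ne_zero (i : ℕ) hs0
    have h7 := pow_ne_zero (N + 2 - i : ℕ) hs0
    rw [h5] at h4
    rw [eq_mul_inv_iff_mul_eq₀ h7]
    apply mul_left_cancel₀ h6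
    linear_combination -h4
  refine ⟨-1 * (s ^ (N + 2))⁻¹, 1 * (s ^ (N + 1))⁻¹, ?_⟩
  convert h2 using 3
  funext i
  rw [hcoeff]
  refine Fin.cases ?_ (fun i => Fin.cases ?_ (fun i => ?_) i) i
  · simp [hv]
  · simp [hv]
  · simp only [hv, Fin.cons_succ, Fin.val_succ]
    rw [show N + 2 - (↑i + 1 + 1) = N - ↑i by omega,
      mul_inv_cancel_right₀ (pow_ne_zero _ hs0)]

theorem totalDegree_aeval_le {σ τ : Type*} (g : σ → MvPolynomial τ ℂ)
    (hg : ∀ i, (g i).totalDegree ≤ 1) (p : MvPolynomial σ ℂ) :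
    (MvPolynomial.aeval g p).totalDegree ≤ p.totalDegree := by
  rw [MvPolynomial.aeval_def, MvPolynomial.eval₂_eq]
  refine MvPolynomial.totalDegree_finsetSum_le fun d hd => ?_
  refine (MvPolynomial.totalDegree_mul _ _).trans ?_
  rw [MvPolynomial.algebraMap_eq, MvPolynomial.totalDegree_C, zero_add]
  refine (MvPolynomial.totalDegree_finsetProd _ _).trans ?_
  refine le_trans ?_ (MvPolynomial.le_totalDegree hd)
  refine Finset.sum_le_sum fun i _ => ?_
  refine (MvPolynomial.totalDegree_pow _ _).trans ?_
  calc d i * (g i).totalDegree ≤ d i * 1 := by gcongr; exact hg i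
    _ = d i := mul_one _

/-- With the coefficients of index at least two prescribed, `O(H)` of the `(2 * H + 1) ^ 2` choices
of the two others produce polynomials with a geometric triple, by the Schwartz–Zippel lemma. -/
theorem exists_card_zeros_le (N : ℕ) : ∃ (Ψ : MvPolynomial (Fin (N + 2)) ℂ) (M : ℕ),
    (∀ z : Fin (N + 2) → ℂ,
      MvPolynomial.eval (fun i : Fin (N + 2) => (∏ j, (X - C (z j))).coeff i) Ψ = 0 ↔
        HasGeometricTriple z) ∧
    ∀ (u : Fin N → ℂ) (S : Finset ℂ), {w ∈ Fintype.piFinset fun _ : Fin 2 => S |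
      MvPolynomial.eval (Fin.cons (w 0) (Fin.cons (w 1) u : Fin (N + 1) → ℂ)) Ψ = 0}.card ≤
        M * S.card := by
  obtain ⟨Ψ, hΨ⟩ := exists_coeffPoly (N + 2)
  refine ⟨Ψ, Ψ.totalDegree, hΨ, fun u S => ?_⟩
  set g : Fin (N + 2) → MvPolynomial (Fin 2) ℂ := Fin.cons (MvPolynomial.X 0)
    (Fin.cons (MvPolynomial.X 1) fun i => MvPolynomial.C (u i) :
      Fin (N + 1) → MvPolynomial (Fin 2) ℂ) with hg
  have heval : ∀ w : Fin 2 → ℂ, MvPolynomial.eval w (MvPolynomial.aeval g Ψ) =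
      MvPolynomial.eval (Fin.cons (w 0) (Fin.cons (w 1) u : Fin (N + 1) → ℂ)) Ψ := by
    intro w
    rw [← MvPolynomial.aeval_eq_eval, ← MvPolynomial.aeval_eq_eval, ← AlgHom.comp_apply,
      MvPolynomial.comp_aeval]
    congr 2
    funext i
    refine Fin.cases ?_ (fun i => Fin.cases ?_ (fun i => ?_) i) i <;>
      simp [hg]
  have hne : MvPolynomial.aeval g Ψ ≠ 0 := by
    obtain ⟨b, a, hba⟩ := exists_eval_ne_zero hΨ u
    intro h0
    have := heval ![b, a]
    rw [h0, map_zero] at this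
    exact hba this.symm
  have hdeg : (MvPolynomial.aeval g Ψ).totalDegree ≤ Ψ.totalDegree := by
    refine totalDegree_aeval_le g (fun i => ?_) Ψ
    refine Fin.cases ?_ (fun i => Fin.cases ?_ (fun i => ?_) i) i <;>
      simp [hg]
  rcases S.eq_empty_or_nonempty with rfl | hS
  · simp
  have hS0 : (0 : ℚ≥0) < S.card := by exact_mod_cast hS.card_pos
  have hsz := MvPolynomial.schwartz_zippel_totalDegree hne S
  simp only [heval] at hsz
  rw [div_le_div_iff₀ (by positivity) hS0, sq, ← mul_assoc] at hsz
  have h1 := le_of_mul_le_mul_right hsz hS0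
  have h2 := (by exact_mod_cast h1 : _ ≤ (MvPolynomial.aeval g Ψ).totalDegree * S.card)
  exact h2.trans (Nat.mul_le_mul_right _ hdeg)

/-! ### The upper bound for an odd number of dominant roots -/

/-- Among an odd number `k ≥ 3` of distinct roots of modulus `R` there are a real one `x` and a pair
of distinct complex conjugates `y`, `w`, and these satisfy `x ^ 2 = R ^ 2 = y * w`. -/
theorem hasGeometricTriple_of_odd {n k H : ℕ} (hk : 3 ≤ k) (hodd : Odd k) {f : ℤ[X]}
    (hf : f ∈ dominantSet n k H) {z : Fin n → ℂ} (hz : Finset.univ.val.map z = complexRoots f) :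
    HasGeometricTriple z := by
  classical
  by_cases hinj : Function.Injective z
  swap
  · exact Or.inl hinj
  have hnodup : (complexRoots f).Nodup := by
    rw [← hz]
    exact Finset.univ.nodup.map hinj
  set F : Finset ℂ := (complexRoots f).toFinset.filter fun x => ‖x‖₊ = house f with hF
  have hcard : F.card = k := by
    rw [← hf.2.2.2, numDominantRoots, Multiset.countP_eq_card_filter, hF, Finset.card_def,
      Finset.filter_val, Multiset.toFinset_val, hnodup.dedup]
  have hmem : ∀ x, x ∈ F ↔ x ∈ complexRoots f ∧ ‖x‖₊ = house f := by
    intro x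
    rw [hF, Finset.mem_filter, Multiset.mem_toFinset]
  have hconj : ∀ x ∈ F, (starRingEnd ℂ) x ∈ F := by
    intro x hx
    rw [hmem] at hx ⊢
    refine ⟨?_, ?_⟩
    · have h1 := (mem_complexRoots hf.1).1 hx.1
      rw [mem_complexRoots hf.1, aeval_def, eval₂_eq_sum_range] at *
      have h2 := congrArg (starRingEnd ℂ) h1
      simpa using h2
    · rw [← hx.2]
      ext
      simp
  have hsq : ∀ x ∈ F, x * (starRingEnd ℂ) x = ((house f : ℝ) : ℂ) ^ 2 := by
    intro x hx
    rw [Complex.mul_conj, Complex.normSq_eq_norm_sq, ← ((hmem x).1 hx).2, coe_nnnorm]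
    push_cast
    rfl
  -- The non-real roots come in pairs, whence the parity of the number of real ones.
  have hupper : (F.filter fun x => 0 < x.im).card = (F.filter fun x => x.im < 0).card := by
    refine Finset.card_bij (fun x _ => (starRingEnd ℂ) x) ?_ ?_ ?_
    · intro x hx
      rw [Finset.mem_filter] at hx ⊢
      exact ⟨hconj x hx.1, by simpa using hx.2⟩
    · intro x _ y _ h
      exact (starRingEnd ℂ).injective h
    · intro y hy
      rw [Finset.mem_filter] at hy
      exact ⟨(starRingEnd ℂ) y, Finset.mem_filter.2 ⟨hconj y hy.1, by simpa using hy.2⟩, by simp⟩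
  have hsplit : F.card = (F.filter fun x => x.im = 0).card +
      ((F.filter fun x => 0 < x.im).card + (F.filter fun x => x.im < 0).card) := by
    rw [← Finset.card_union_of_disjoint, ← Finset.card_union_of_disjoint]
    · congr 1
      ext x
      simp only [Finset.mem_union, Finset.mem_filter]
      have := lt_trichotomy x.im 0
      tauto
    · rw [Finset.disjoint_left]
      intro x hx hx'
      simp only [Finset.mem_union, Finset.mem_filter] at hx hx'
      rcases hx' with h | h <;> linarith [h.2, hx.2]
    · rw [Finset.disjoint_left]
      intro x hx hx'
      simp only [Finset.mem_filter] at hx hx'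
      linarith [hx.2, hx'.2]
  have hreal : (F.filter fun x => x.im = 0) ⊆ {((house f : ℝ) : ℂ), -((house f : ℝ) : ℂ)} := by
    intro x hx
    obtain ⟨hxF, hx0⟩ := Finset.mem_filter.1 hx
    have h1 := hsq x hxF
    rw [Complex.conj_eq_iff_im.2 hx0, ← sq, sq_eq_sq_iff_eq_or_eq_neg] at h1
    simpa using h1
  have hreal2 := (Finset.card_le_card hreal).trans Finset.card_le_two
  obtain ⟨m, hm⟩ := hodd
  obtain ⟨x, hx⟩ : (F.filter fun x => x.im = 0).Nonempty := by
    rw [← Finset.card_pos]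
    omega
  obtain ⟨y, hy⟩ : (F.filter fun x => 0 < x.im).Nonempty := by
    rw [← Finset.card_pos]
    omega
  obtain ⟨hxF, hx0⟩ := Finset.mem_filter.1 hx
  obtain ⟨hyF, hy0⟩ := Finset.mem_filter.1 hy
  have hidx : ∀ w ∈ F, ∃ p, z p = w := by
    intro w hw
    have h1 := ((hmem w).1 hw).1
    rw [← hz] at h1
    obtain ⟨p, -, hp⟩ := Multiset.mem_map.1 h1
    exact ⟨p, hp⟩
  obtain ⟨p, hp⟩ := hidx x hxF
  obtain ⟨q, hq⟩ := hidx y hyF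
  obtain ⟨r, hr⟩ := hidx _ (hconj y hyF)
  have him : ((starRingEnd ℂ) y).im < 0 := by simpa using hy0
  refine Or.inr ⟨p, q, r, ?_, ?_, ?_, ?_⟩
  · rintro rfl
    rw [← hq, hp, hx0] at hy0
    exact lt_irrefl _ hy0
  · rintro rfl
    rw [← hr, hp, hx0] at him
    exact lt_irrefl _ him
  · rintro rfl
    rw [← hr, hq] at him
    linarith
  · rw [hp, hq, hr, hsq y hyF, ← hsq x hxF, Complex.conj_eq_iff_im.2 hx0, sq]

theorem upper_bound_odd_of_lt {n k : ℕ} (hk : 3 ≤ k) (hodd : Odd k) (hkn : k + 1 ≤ n) :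
    ∃ C : ℝ, 0 < C ∧ ∀ H : ℕ, 1 ≤ H →
      (D n k H : ℝ) ≤ C * (H : ℝ) ^ ((n : ℝ) - ((k : ℝ) + 1) / 2) := by
  classical
  obtain ⟨N, rfl⟩ : ∃ N, n = N + 2 := ⟨n - 2, by omega⟩
  obtain ⟨Ψ, M, hΨ, hM⟩ := exists_card_zeros_le N
  refine upper_bound_of_fiber_le (by omega) hkn (M * 3) fun H hH (u : Fin N → ℤ) => ?_
  change (windowFiber (N + 2) k H 2 N u).ncard ≤ _
  set S : Finset ℂ := (Finset.Icc (-(H : ℤ)) H).image fun a : ℤ => (a : ℂ) with hS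
  have hScard : S.card ≤ 3 * H := by
    refine Finset.card_image_le.trans ?_
    rw [Int.card_Icc]
    omega
  have hZ := hM (fun i => (u i : ℂ)) S
  calc (windowFiber (N + 2) k H 2 N u).ncard ≤ M * S.card := by
        refine le_trans ?_ hZ
        rw [← Set.ncard_coe_finset]
        refine Set.ncard_le_ncard_of_injOn
          (fun f => fun i : Fin 2 => ((f.coeff i : ℤ) : ℂ)) ?_ ?_ (Set.toFinite _)
        · intro f hf
          rw [Finset.mem_coe, Finset.mem_filter, Fintype.mem_piFinset]
          refine ⟨fun i => ?_, ?_⟩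
          · refine Finset.mem_image.2 ⟨f.coeff i, ?_, rfl⟩
            have := (natAbs_coeff_le_height f i).trans hf.1.2.2.1
            rw [Finset.mem_Icc]
            omega
          · obtain ⟨z, hz⟩ := exists_fin_map_eq (complexRoots f)
              (by rw [card_complexRoots hf.1.1, hf.1.2.1])
            have h1 := (hΨ z).2 (hasGeometricTriple_of_odd hk hodd hf.1 hz)
            have h2 : f.map (Int.castRingHom ℂ) = ∏ j, (X - C (z j)) := by
              rw [map_eq_prod_complexRoots hf.1.1, ← hz, Multiset.map_map]
              rfl
            rw [← h2] at h1
            convert h1 using 2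
            congr 1
            funext i
            refine Fin.cases ?_ (fun i => Fin.cases ?_ (fun i => ?_) i) i
            · simp
            · simp
            · simp only [Fin.cons_succ, ← hf.2, coeffWindow, coeff_map, eq_intCast, Fin.val_succ]
              rw [show 2 + (i : ℕ) = i + 1 + 1 by omega]
        · intro f hf g hg hfg
          refine eq_of_mem_windowFiber (by omega) hf hg fun i hi => ?_
          have := congrFun hfg ⟨i, hi⟩
          simpa using this
    _ ≤ M * (3 * H) := by gcongr
    _ = M * 3 * H := by ring

theorem upper_bound_odd {n k : ℕ} (hk : 3 ≤ k) (hodd : Odd k) (hkn : k ≤ n) :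
    ∃ C : ℝ, 0 < C ∧ ∀ H : ℕ, 1 ≤ H →
      (D n k H : ℝ) ≤ C * (H : ℝ) ^ ((n : ℝ) - ((k : ℝ) + 1) / 2) := by
  rcases hkn.eq_or_lt with rfl | h
  · exact upper_bound_odd_self hodd hk
  · exact upper_bound_odd_of_lt hk hodd h

end DominantRoots


theorem theorem1p1 (n k : ℕ) (hk : 3 ≤ k) (hkn : k ≤ n) :
    (Odd k → ∃ c C : ℝ, 0 < c ∧ 0 < C ∧ ∀ H : ℕ, 1 ≤ H →
      c * (H : ℝ) ^ (((n : ℝ) + 1) / 2 - (k : ℝ)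
          + (5 * (k : ℝ) ^ 2 - 4 * (k : ℝ) + 7) / (8 * (n : ℝ)))
        ≤ (DominantRoots.D n k H : ℝ) ∧
      (DominantRoots.D n k H : ℝ) ≤ C * (H : ℝ) ^ ((n : ℝ) - ((k : ℝ) + 1) / 2)) ∧
    (Even k → ∃ c C : ℝ, 0 < c ∧ 0 < C ∧ ∀ H : ℕ, 1 ≤ H →
      c * (H : ℝ) ^ (((n : ℝ) + 1) / 2 - (k : ℝ)
          + (5 * (k : ℝ) ^ 2 - 2 * (k : ℝ) + 16) / (8 * (n : ℝ)))
        ≤ (DominantRoots.D n k H : ℝ) ∧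
      (DominantRoots.D n k H : ℝ) ≤ C * (H : ℝ) ^ ((n : ℝ) - ((k : ℝ) - 1) / 2)) := by
  have hn0 : (n : ℝ) ≠ 0 := by
    have : n ≠ 0 := by omega
    exact_mod_cast this
  have htri : ∀ m : ℕ, ((m * (m + 1) / 2 : ℕ) : ℝ) = m * (m + 1) / 2 := by
    intro m
    rw [Nat.cast_div (Nat.even_mul_succ_self m).two_dvd (by norm_num)]
    push_cast
    ring
  obtain ⟨d, rfl⟩ := Nat.exists_eq_add_of_le hkn
  constructor
  · intro hodd
    obtain ⟨C, hC, hupper⟩ := DominantRoots.upper_bound_odd hk hodd hkn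
    obtain ⟨m, rfl⟩ := hodd
    obtain ⟨c, hc, hlower⟩ := DominantRoots.lower_bound_odd (m := m) (d := d) (by omega) rfl
    refine ⟨c, C, hc, hC, fun H hH => ⟨?_, hupper H hH⟩⟩
    refine le_of_eq_of_le ?_ (hlower H hH)
    congr 2
    push_cast [htri] at hn0 ⊢
    field_simp
    ring
  · intro heven
    obtain ⟨C, hC, hupper⟩ := DominantRoots.upper_bound_even (by omega : 1 ≤ k) hkn
    obtain ⟨m, rfl⟩ := heven.exists_two_nsmul
    rw [smul_eq_mul] at *
    obtain ⟨c, hc, hlower⟩ := DominantRoots.lower_bound_even (m := m) (d := d) (by omega) rfl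
    refine ⟨c, C, hc, hC, fun H hH => ⟨?_, hupper H hH⟩⟩
    refine le_of_eq_of_le ?_ (hlower H hH)
    congr 2
    push_cast [htri] at hn0 ⊢
    field_simp
    ring
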